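/- Let $\rho=|\psi\rangle\langle\psi|$ be a pure Gaussian state of $N$ bosonic modes on $L^2(\mathbb R^N)$, with quadratures $\hat R=(\hat q_1,\hat p_1,\dots,\hat q_N,\hat p_N)$, $[\hat q_k,\hat p_l]=i\delta_{kl}$, Hamiltonian $H=\tfrac12\sum_{k=1}^N(\hat q_k^2+\hat p_k^2)$, and covariance matrix $\Sigma_{st}=\langle \hat R_s\hat R_t+\hat R_t\hat R_s\rangle-2\langle\hat R_s\rangle\langle\hat R_t\rangle$. Let the set of modes be partitioned into $k$ disjoint non-empty sets $\mathcal A_1,\dots,\mathcal A_k$ with $|\mathcal A_j|=m_j$, $\sum_j m_j=N$, and let $\bar{\mathcal A}_j$ be the complement of $\mathcal A_j$. The global Gaussian ergotropy is $\mathcal E_G(\rho)=\operatorname{Tr}(\rho H)-\min_U\operatorname{Tr}(U\rho U^\dagger H)$, the minimum being over all Gaussian unitaries $U$ of the $N$ modes (unitaries acting on the quadratures by affine symplectic maps). For a family of disjoint sets of modes $\mathcal B_1,\dots,\mathcal B_l$ with union the set of all modes, the $l$-local Gaussian ergotropy $\mathcal E^{\mathcal B_1|\cdots|\mathcal B_l}_{l\text{-loc}}(\rho)$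 is defined in the same way with the minimum over all $U=\bigotimes_{j=1}^l U_{\mathcal B_j}$, where $U_{\mathcal B_j}$ is a Gaussian unitary of the modes in $\mathcal B_j$, and the $l$-local ergotropic gap is $\delta^{\mathcal B_1|\cdots|\mathcal B_l}_{l\text{-loc}}(\rho)=\mathcal E_G(\rho)-\mathcal E^{\mathcal B_1|\cdots|\mathcal B_l}_{l\text{-loc}}(\rho)$. Then $\operatorname{Tr}(\rho H)$ is finite, all minima entering the gaps below exist, and $$\delta^{\mathcal A_1|\cdots|\mathcal A_k}_{k\text{-loc}}(\rho)=\frac12\sum_{j=1}^k\sum_{i=1}^{m_j}\bigl(\nu_i^{\mathcal A_j}-1\bigr),$$ where $\nu^{\mathcal A_j}_1,\dots,\nu^{\mathcal A_j}_{m_j}$ are the symplectic eigenvalues of the reduced covariance matrix $\Sigma_{\mathcal A_j}$ of the modes in $\mathcal A_j$, that is, the positive eigenvalues, with multiplicity, of $i\Omega\Sigma_{\mathcal A_j}$, with $\Omega$ the symplectic form (there are exactly $m_j$ of them). Moreover, $$\delta^{\mathcal A_1|\cdots|\mathcal A_k}_{k\text{-loc}}(\rho)=\frac12\sum_{j=1}^k\delta^{\mathcal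 A_j|\bar{\mathcal A}_j}_{2\text{-loc}}(\rho),\qquad \delta^{\mathcal A_j|\bar{\mathcal A}_j}_{2\text{-loc}}(\rho)=\sum_{i=1}^{m_j}\bigl(\nu_i^{\mathcal A_j}-1\bigr)\quad(1\le j\le k).$$ -/

import Mathlib

noncomputable section

namespace ErgotropicGap

open MeasureTheory Matrix

variable {ι : Type*} [Fintype ι]

/-- The Hilbert space `L²(ℝ^ι)` of a system of bosonic modes labelled by `ι`. -/
abbrev Modes (ι : Type*) [Fintype ι] : Type _ :=
  Lp ℂ 2 (volume : Measure (ι → ℝ))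

/-- The function `x ↦ exp (i (b·x - a·b/2)) f (x - a)`, where `ξ = (a, b)`. -/
def weylFun (ξ : ι ⊕ ι → ℝ) (f : (ι → ℝ) → ℂ) (x : ι → ℝ) : ℂ :=
  Complex.exp (Complex.I *
      (((∑ i, ξ (Sum.inr i) * x i) - (∑ i, ξ (Sum.inl i) * ξ (Sum.inr i)) / 2 : ℝ) : ℂ)) *
    f (x - fun i => ξ (Sum.inl i))

theorem memLp_weylFun (ξ : ι ⊕ ι → ℝ) (f : Modes ι) :
    MemLp (weylFun ξ f) 2 (volume : Measure (ι → ℝ)) := by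
  have h1 : MemLp (fun x : ι → ℝ => f (x - fun i => ξ (Sum.inl i))) 2 volume :=
    (Lp.memLp f).comp_measurePreserving (measurePreserving_sub_right volume _)
  refine h1.of_le ?_ (Filter.Eventually.of_forall fun x => ?_)
  · refine AEStronglyMeasurable.mul (Continuous.aestronglyMeasurable ?_) h1.1
    fun_prop
  · rw [weylFun, norm_mul, mul_comm Complex.I, Complex.norm_exp_ofReal_mul_I, one_mul]

/-- The Weyl (displacement) operator `exp (i (b·q - a·p))`, `ξ = (a, b)`, on `L²(ℝ^ι)`. -/
def weyl (ξ : ι ⊕ ι → ℝ) (f : Modes ι) : Modes ι :=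
  (memLp_weylFun ξ f).toLp _

section Quadratures

variable [DecidableEq ι]

/-- The orbit of `ψ` under the one-parameter unitary group `exp (i t q_k)` (for `Sum.inl k`),
respectively `exp (-i t p_k)` (for `Sum.inr k`). -/
def orbit (ψ : Modes ι) : ι ⊕ ι → ℝ → Modes ι
  | Sum.inl k => fun t => weyl (t • Pi.single (Sum.inr k) 1) ψ
  | Sum.inr k => fun t => weyl (t • Pi.single (Sum.inl k) 1) ψ

/-- The quadrature operators `q_k` (index `Sum.inl k`) and `p_k` (index `Sum.inr k`), as the
self-adjoint generators of their unitary groups; the value is meaningful for `ψ` in the domain,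
that is, where the orbit is differentiable at `0`. -/
def quad (ψ : Modes ι) : ι ⊕ ι → Modes ι
  | Sum.inl k => (-Complex.I) • deriv (orbit ψ (Sum.inl k)) 0
  | Sum.inr k => Complex.I • deriv (orbit ψ (Sum.inr k)) 0

/-- `ψ` lies in the domain of every `q_k` and `p_k`, i.e. in the form domain of
`H = ½ ∑ₖ (q_k² + p_k²)`. -/
def FiniteEnergy (ψ : Modes ι) : Prop :=
  ∀ s, DifferentiableAt ℝ (orbit ψ s) 0

/-- `⟨ψ, H ψ⟩` for `H = ½ ∑ₖ (q_k² + p_k²)` (as a quadratic form, for `FiniteEnergy ψ`). -/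
def energy (ψ : Modes ι) : ℝ :=
  (1 / 2) * ∑ s, ‖quad ψ s‖ ^ 2

/-- First moments `⟨R_s⟩`. -/
def meanVec (ψ : Modes ι) (s : ι ⊕ ι) : ℝ :=
  (inner ℂ ψ (quad ψ s)).re

/-- Covariance matrix `Σ_{st} = ⟨R_s R_t + R_t R_s⟩ - 2 ⟨R_s⟩⟨R_t⟩`, the first term being
`2 Re ⟨R_s ψ, R_t ψ⟩`. -/
def covMatrix (ψ : Modes ι) : Matrix (ι ⊕ ι) (ι ⊕ ι) ℝ :=
  Matrix.of fun s t =>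
    2 * (inner ℂ (quad ψ s) (quad ψ t)).re - 2 * meanVec ψ s * meanVec ψ t

/-- Covariance matrix of the reduced state on the modes in `B`. -/
def reducedCov (B : Finset ι) (ψ : Modes ι) : Matrix (B ⊕ B) (B ⊕ B) ℝ :=
  (covMatrix ψ).submatrix (Sum.map Subtype.val Subtype.val) (Sum.map Subtype.val Subtype.val)

/-- The symplectic eigenvalues of a positive definite matrix `M`: the positive eigenvalues of
`i Ω M`, with multiplicity, where `Ω = -J` is the symplectic form in the ordering `(q, p)`. -/
def symplecticEigenvalues (M : Matrix (ι ⊕ ι) (ι ⊕ ι) ℝ) : Multiset ℝ :=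
  ((Complex.I • ((-(Matrix.J ι ℝ)) * M).map Complex.ofReal).charpoly.roots.map
    Complex.re).filter (fun x => 0 < x)

end Quadratures

/-- `ψ` is a unit vector and the characteristic function of the pure state `|ψ⟩⟨ψ|` is
Gaussian (first moments arbitrary). -/
def IsPureGaussian (ψ : Modes ι) : Prop :=
  ‖ψ‖ = 1 ∧ ∃ (d : ι ⊕ ι → ℝ) (M : Matrix (ι ⊕ ι) (ι ⊕ ι) ℝ), M.IsSymm ∧
    ∀ ξ, inner ℂ ψ (weyl ξ ψ) =
      Complex.exp (Complex.I * ((d ⬝ᵥ ξ : ℝ) : ℂ) - ((ξ ⬝ᵥ M *ᵥ ξ / 4 : ℝ) : ℂ))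

section Unitaries

variable [DecidableEq ι]

/-- Gaussian unitaries: unitaries that act on the phase space by an affine symplectic map,
expressed on Weyl operators, `U W(ξ) U† = exp (i d·ξ) W(S ξ)`. -/
def IsGaussianUnitary (U : Modes ι ≃ₗᵢ[ℂ] Modes ι) : Prop :=
  ∃ S ∈ Matrix.symplecticGroup ι ℝ, ∃ d : ι ⊕ ι → ℝ, ∀ (ξ : ι ⊕ ι → ℝ) (f : Modes ι),
    U (weyl ξ f) = Complex.exp (Complex.I * ((d ⬝ᵥ ξ : ℝ) : ℂ)) • weyl (S *ᵥ ξ) (U f)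

variable {κ : Type*} [Fintype κ]

/-- `F = ⨂_j f_j`, for `f_j ∈ L²(ℝ^{A_j})`. -/
def IsProductVector (A : κ → Finset ι) (f : ∀ j, Modes (A j)) (F : Modes ι) : Prop :=
  (F : (ι → ℝ) → ℂ) =ᵐ[volume] fun x => ∏ j, f j (fun i => x i)

/-- Local Gaussian unitaries `U = ⨂_j U_j`, each `U_j` a Gaussian unitary of the modes `A_j`. -/
def IsLocalGaussianUnitary (A : κ → Finset ι) (U : Modes ι ≃ₗᵢ[ℂ] Modes ι) : Prop :=
  ∃ V : ∀ j, Modes (A j) ≃ₗᵢ[ℂ] Modes (A j), (∀ j, IsGaussianUnitary (V j)) ∧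
    ∀ (f : ∀ j, Modes (A j)) (F : Modes ι),
      IsProductVector A f F → IsProductVector A (fun j => V j (f j)) (U F)

/-- The (finite) energies reachable from `ψ` by Gaussian unitaries. -/
def globalEnergies (ψ : Modes ι) : Set ℝ :=
  {e | ∃ U : Modes ι ≃ₗᵢ[ℂ] Modes ι,
    IsGaussianUnitary U ∧ FiniteEnergy (U ψ) ∧ e = energy (U ψ)}

/-- The (finite) energies reachable from `ψ` by local Gaussian unitaries. -/
def localEnergies (A : κ → Finset ι) (ψ : Modes ι) : Set ℝ :=
  {e | ∃ U : Modes ι ≃ₗᵢ[ℂ] Modes ι,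
    IsLocalGaussianUnitary A U ∧ FiniteEnergy (U ψ) ∧ e = energy (U ψ)}

/-- Global Gaussian ergotropy. -/
def globalErgotropy (ψ : Modes ι) : ℝ :=
  energy ψ - sInf (globalEnergies ψ)

/-- Local Gaussian ergotropy with respect to the partition `A`. -/
def localErgotropy (A : κ → Finset ι) (ψ : Modes ι) : ℝ :=
  energy ψ - sInf (localEnergies A ψ)

/-- Local ergotropic gap with respect to the partition `A`. -/
def ergotropicGap (A : κ → Finset ι) (ψ : Modes ι) : ℝ :=
  globalErgotropy ψ - localErgotropy A ψ

end Unitaries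

end ErgotropicGap

noncomputable section

namespace ErgotropicGap

open MeasureTheory Matrix Filter Topology

/-! A pure Gaussian vector has a Gaussian characteristic function `ξ ↦ ⟨φ, W(ξ) φ⟩`, with
covariance matrix `M`. Positivity of the Gram matrix of the quadratures gives the uncertainty
relation, so `M` is positive definite with symplectic eigenvalues at least `1`, while the Moyal
identity for the Weyl operators forces `det M = 1`. Hence all symplectic eigenvalues of `M` are `1`.

A Gaussian unitary replaces `M` by `Lᵀ M L` with `L` symplectic, and the energy is
`tr (Lᵀ M L) / 4 + |d|² / 2`. By Williamson's theorem the trace is at least twice the sum of the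
symplectic eigenvalues, and this bound is attained by a displacement followed by a chirp and a
dilation, because every positive definite symplectic matrix is `L Lᵀ` with `L` block lower
triangular. Local unitaries act through block diagonal `L`, so for them the minimum splits over the
parts of the partition.

For a bipartition the two parts contribute equally, because purity means `(J M)² = -1`. -/

section SkewSymmetric

variable {n : Type*} [Fintype n]

theorem dotProduct_eq_zero_of_transpose_eq_neg {R : Type*} [CommRing R] [IsDomain R]
    {H : Matrix n n R} (hH : Hᵀ = -H) {v w : n → R} {a b : R} (hv : H *ᵥ v = a • v)
    (hw : H *ᵥ w = b • w) (hab : a + b ≠ 0) : v ⬝ᵥ w = 0 := by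
  have h : a * (v ⬝ᵥ w) = -(b * (v ⬝ᵥ w)) := by
    calc a * (v ⬝ᵥ w) = (H *ᵥ v) ⬝ᵥ w := by rw [hv, smul_dotProduct, smul_eq_mul]
      _ = v ⬝ᵥ (Hᵀ *ᵥ w) := by rw [mulVec_transpose, dotProduct_comm, dotProduct_mulVec,
        dotProduct_comm]
      _ = -(b * (v ⬝ᵥ w)) := by
        rw [hH, neg_mulVec, hw, dotProduct_neg, dotProduct_smul, smul_eq_mul]
  refine (mul_eq_zero.1 ?_).resolve_left hab
  linear_combination h

variable [DecidableEq n]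

theorem roots_charpoly_diagonal {R : Type*} [CommRing R] [IsDomain R] (f : n → R) :
    (diagonal f).charpoly.roots = Finset.univ.val.map f := by
  rw [charpoly_diagonal, Polynomial.roots_prod _ _
    (Finset.prod_ne_zero_iff.2 fun i _ => Polynomial.X_sub_C_ne_zero _)]
  simp only [Polynomial.roots_X_sub_C, Multiset.bind_singleton]

theorem map_neg_eigenvalues_of_transpose_eq_neg {H : Matrix n n ℂ} (hH : H.IsHermitian)
    (hskew : Hᵀ = -H) :
    Finset.univ.val.map (-hH.eigenvalues) = Finset.univ.val.map hH.eigenvalues := by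
  have hneg : H.charpoly = (diagonal fun i => (((-hH.eigenvalues) i : ℝ) : ℂ)).charpoly := by
    conv_lhs => rw [← charpoly_transpose, hskew, hH.spectral_theorem, Unitary.conjStarAlgAut_apply,
      ← neg_mul, ← mul_neg, charpoly_mul_comm, ← mul_assoc, Unitary.coe_star_mul_self, one_mul,
      diagonal_neg]
    congr 2
    ext i
    simp
  have hroots := hH.roots_charpoly_eq_eigenvalues
  rw [hneg, roots_charpoly_diagonal] at hroots
  simpa [Multiset.map_map, Function.comp_def] using congrArg (Multiset.map Complex.re) hroots

end SkewSymmetric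

section SkewNormalForm

variable {ι : Type*} [Fintype ι]

theorem card_pos_eq_of_map_neg_eq {f : ι ⊕ ι → ℝ} (h0 : ∀ s, f s ≠ 0)
    (hf : Finset.univ.val.map (-f) = Finset.univ.val.map f) :
    Fintype.card {s // 0 < f s} = Fintype.card ι := by
  have hneg : Fintype.card {s // 0 < f s} = Fintype.card {s // ¬ 0 < f s} := by
    have h := congrArg (Multiset.countP fun x : ℝ => 0 < x) hf
    rw [Multiset.countP_map, Multiset.countP_map] at h
    rw [Fintype.card_subtype, Fintype.card_subtype]
    refine h.symm.trans (congrArg Multiset.card (Multiset.filter_congr fun s _ => ?_))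
    rw [Pi.neg_apply, neg_pos, not_lt, (h0 s).le_iff_lt]
  have hsum := Fintype.card_subtype_compl fun s => 0 < f s
  rw [Fintype.card_sum, ← hneg] at hsum
  have := Fintype.card_subtype_le fun s => 0 < f s
  rw [Fintype.card_sum] at this
  omega

theorem isHermitian_I_smul_map {n : Type*} {K : Matrix n n ℝ} (hK : Kᵀ = -K) :
    (Complex.I • K.map Complex.ofReal).IsHermitian := by
  ext s t
  have h : K t s = -K s t := congrFun (congrFun hK s) t
  simp [h]

theorem transpose_I_smul_map {n : Type*} {K : Matrix n n ℝ} (hK : Kᵀ = -K) :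
    (Complex.I • K.map Complex.ofReal)ᵀ = -(Complex.I • K.map Complex.ofReal) := by
  ext s t
  have h : K t s = -K s t := congrFun (congrFun hK s) t
  simp [h]

variable [DecidableEq ι]

theorem exists_pos_eigenvectors_of_skew {K : Matrix (ι ⊕ ι) (ι ⊕ ι) ℝ} (hK : Kᵀ = -K)
    (hdet : K.det ≠ 0) : ∃ (ν : ι → ℝ) (v : ι → ι ⊕ ι → ℂ), (∀ k, 0 < ν k) ∧
      (∀ k, (Complex.I • K.map Complex.ofReal) *ᵥ v k = (ν k : ℂ) • v k) ∧
      ∀ k l, star (v k) ⬝ᵥ v l = if k = l then 1 else 0 := by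
  have hH := isHermitian_I_smul_map hK
  have h0 : ∀ s, hH.eigenvalues s ≠ 0 := by
    have hdetH : (Complex.I • K.map Complex.ofReal).det ≠ 0 := by
      rw [det_smul]
      refine mul_ne_zero (pow_ne_zero _ Complex.I_ne_zero) ?_
      have h := (Complex.ofRealHom.map_det K).symm
      change (K.map Complex.ofReal).det = _ at h
      rw [h]
      exact Complex.ofReal_ne_zero.2 hdet
    rw [hH.det_eq_prod_eigenvalues, Finset.prod_ne_zero_iff] at hdetH
    exact fun s => Complex.ofReal_ne_zero.1 (hdetH s (Finset.mem_univ s))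
  have hneg := map_neg_eigenvalues_of_transpose_eq_neg hH (transpose_I_smul_map hK)
  have e := Fintype.equivOfCardEq (card_pos_eq_of_map_neg_eq h0 hneg).symm
  refine ⟨fun k => hH.eigenvalues (e k), fun k => hH.eigenvectorBasis (e k), fun k => (e k).2,
    fun k => ?_, fun k l => ?_⟩
  · rw [hH.mulVec_eigenvectorBasis]
    rfl
  · have h := orthonormal_iff_ite.1 hH.eigenvectorBasis.orthonormal (e k) (e l)
    rw [EuclideanSpace.inner_eq_star_dotProduct, dotProduct_comm] at h
    rw [h]
    simp only [Subtype.coe_inj, e.injective.eq_iff]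

end SkewNormalForm

section Williamson

open scoped MatrixOrder ComplexOrder

variable {ι : Type*} [Fintype ι] [DecidableEq ι]

/-- The matrix whose columns are the vectors `√2 Re (v k)`, followed by the `√2 Im (v k)`. -/
def realFrame (v : ι → ι ⊕ ι → ℂ) : Matrix (ι ⊕ ι) (ι ⊕ ι) ℝ :=
  of fun s => Sum.elim (fun k => √2 * (v k s).re) (fun k => √2 * (v k s).im)

theorem realFrame_transpose_mul_self {v : ι → ι ⊕ ι → ℂ} (h₁ : ∀ k l, v k ⬝ᵥ v l = 0)
    (h₂ : ∀ k l, star (v k) ⬝ᵥ v l = if k = l then 1 else 0) :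
    (realFrame v)ᵀ * realFrame v = 1 := by
  have hsum (f g : ι ⊕ ι → ℝ) : ∑ s, √2 * f s * (√2 * g s) = 2 * ∑ s, f s * g s := by
    rw [Finset.mul_sum]
    refine Finset.sum_congr rfl fun s _ => ?_
    rw [mul_mul_mul_comm, Real.mul_self_sqrt zero_le_two]
  ext s t
  rcases s with k | k <;> rcases t with l | l <;>
  · obtain ⟨re₁, im₁⟩ := Complex.ext_iff.1 (h₁ k l)
    obtain ⟨re₂, im₂⟩ := Complex.ext_iff.1 (h₂ k l)
    simp only [dotProduct, Complex.re_sum, Complex.im_sum, Complex.mul_re, Complex.mul_im,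
      Pi.star_apply, RCLike.star_def, Complex.conj_re, Complex.conj_im, Finset.sum_sub_distrib,
      Finset.sum_add_distrib, apply_ite Complex.re, apply_ite Complex.im, Complex.one_re,
      Complex.one_im, Complex.zero_re, Complex.zero_im, ite_self, neg_mul, sub_neg_eq_add,
      Finset.sum_neg_distrib] at re₁ im₁ re₂ im₂
    simp only [realFrame, mul_apply, transpose_apply, of_apply, Sum.elim_inl, Sum.elim_inr, hsum,
      one_apply, Sum.inl.injEq, Sum.inr.injEq, reduceCtorEq, if_false]
    linarith

theorem mul_realFrame {K : Matrix (ι ⊕ ι) (ι ⊕ ι) ℝ} {v : ι → ι ⊕ ι → ℂ} {ν : ι → ℝ}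
    (h : ∀ k, (Complex.I • K.map Complex.ofReal) *ᵥ v k = (ν k : ℂ) • v k) :
    K * realFrame v = realFrame v * (J ι ℝ * diagonal (Sum.elim ν ν)) := by
  have hJ : J ι ℝ * diagonal (Sum.elim ν ν) = fromBlocks 0 (-diagonal ν) (diagonal ν) 0 := by
    rw [J, ← fromBlocks_diagonal, fromBlocks_multiply]
    simp
  have hre (k : ι) (s : ι ⊕ ι) : ∑ x, K s x * (√2 * (v k x).re) = √2 * (v k s).im * ν k := by
    have e : ∑ x, K s x * (v k x).re = ν k * (v k s).im := by
      simpa [-Fintype.sum_sum_type, smul_mulVec, mulVec, dotProduct] using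
        congrArg Complex.im (congrFun (h k) s)
    simp_rw [mul_left_comm _ √2, ← Finset.mul_sum, e, mul_assoc, mul_comm]
  have him (k : ι) (s : ι ⊕ ι) : ∑ x, K s x * (√2 * (v k x).im) = -(√2 * (v k s).re * ν k) := by
    have e : -∑ x, K s x * (v k x).im = ν k * (v k s).re := by
      simpa [-Fintype.sum_sum_type, smul_mulVec, mulVec, dotProduct] using
        congrArg Complex.re (congrFun (h k) s)
    rw [mul_assoc, mul_comm (v k s).re, ← e, mul_neg, neg_neg, Finset.mul_sum]
    exact Finset.sum_congr rfl fun x _ => mul_left_comm _ _ _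
  ext s t
  rw [mul_apply, mul_apply, hJ, Fintype.sum_sum_type (fun x => realFrame v s x * _)]
  rcases t with k | k <;>
    simp [-Fintype.sum_sum_type, realFrame, hre, him, diagonal_apply]

theorem exists_orthogonal_normalForm_of_skew {K : Matrix (ι ⊕ ι) (ι ⊕ ι) ℝ} (hK : Kᵀ = -K)
    (hdet : K.det ≠ 0) : ∃ (O : Matrix (ι ⊕ ι) (ι ⊕ ι) ℝ) (ν : ι → ℝ), Oᵀ * O = 1 ∧
      (∀ k, 0 < ν k) ∧ Oᵀ * K * O = J ι ℝ * diagonal (Sum.elim ν ν) := by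
  obtain ⟨ν, v, hν, hv, horth⟩ := exists_pos_eigenvectors_of_skew hK hdet
  have hO : (realFrame v)ᵀ * realFrame v = 1 := by
    refine realFrame_transpose_mul_self (fun k l => ?_) horth
    refine dotProduct_eq_zero_of_transpose_eq_neg (transpose_I_smul_map hK) (hv k) (hv l) ?_
    exact_mod_cast (add_pos (hν k) (hν l)).ne'
  exact ⟨realFrame v, ν, hO, hν, by rw [mul_assoc, mul_realFrame hv, ← mul_assoc, hO, one_mul]⟩

theorem exists_posDef_sqrt {n : Type*} [Fintype n] {M : Matrix n n ℝ} (hM : M.PosDef) :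
    ∃ R : Matrix n n ℝ, R.PosDef ∧ R * R = M := by
  classical
  have h : CFC.sqrt M * CFC.sqrt M = M := CFC.sqrt_mul_sqrt_self M hM.posSemidef.nonneg
  refine ⟨CFC.sqrt M, ?_, h⟩
  rw [(CFC.sqrt_nonneg M).posSemidef.posDef_iff_det_ne_zero]
  intro h0
  refine hM.det_pos.ne' ?_
  rw [← h, det_mul, h0, zero_mul]

theorem transpose_eq_of_posDef {n : Type*} {M : Matrix n n ℝ} (hM : M.PosDef) : Mᵀ = M := by
  rw [← conjTranspose_eq_transpose_of_trivial, hM.isHermitian]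

theorem J_mul_diagonal (ν : ι → ℝ) :
    J ι ℝ * diagonal (Sum.elim ν ν) = diagonal (Sum.elim ν ν) * J ι ℝ := by
  rw [J, ← fromBlocks_diagonal, fromBlocks_multiply, fromBlocks_multiply]
  simp

theorem diagonal_inv_mul_self_mul_diagonal_inv {n : Type*} [Fintype n] [DecidableEq n]
    {f g : n → ℝ} (h : ∀ i, g i * f i * g i = 1) :
    diagonal g * diagonal f * diagonal g = 1 := by
  simp only [diagonal_mul_diagonal, h, diagonal_one]

-- Williamson's theorem, read off from the normal form of the skew matrix `√M J √M`.
theorem exists_symplectic_diagonalization {M : Matrix (ι ⊕ ι) (ι ⊕ ι) ℝ} (hM : M.PosDef) :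
    ∃ T ∈ symplecticGroup ι ℝ, ∃ ν : ι → ℝ, (∀ k, 0 < ν k) ∧
      Tᵀ * diagonal (Sum.elim ν ν) * T = M := by
  obtain ⟨R, hR, rfl⟩ := exists_posDef_sqrt hM
  have hRt := transpose_eq_of_posDef hR
  have hRu : IsUnit R.det := hR.det_pos.ne'.isUnit
  obtain ⟨O, ν, hO, hν, hK⟩ := exists_orthogonal_normalForm_of_skew (K := R * J ι ℝ * R)
    (by rw [transpose_mul, transpose_mul, hRt, J_transpose, neg_mul, mul_neg, mul_assoc])
    (by rw [det_mul, det_mul]; exact ((hRu.mul (isUnit_det_J ι ℝ)).mul hRu).ne_zero)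
  let D := diagonal (Sum.elim ν ν)
  let E := diagonal (Sum.elim (fun k => (√(ν k))⁻¹) (fun k => (√(ν k))⁻¹))
  have hEt : Eᵀ = E := diagonal_transpose _
  have hEDE : E * D * E = 1 := by
    refine diagonal_inv_mul_self_mul_diagonal_inv ?_
    rintro (k | k) <;>
    · have := Real.mul_self_sqrt (hν k).le
      have := Real.sqrt_pos.2 (hν k)
      simp only [Sum.elim_inl, Sum.elim_inr]
      field_simp
      nlinarith
  refine ⟨E * Oᵀ * R, SymplecticGroup.mem_iff.2 ?_, ν, hν, ?_⟩
  · calc E * Oᵀ * R * J ι ℝ * (E * Oᵀ * R)ᵀ = E * (Oᵀ * (R * J ι ℝ * R) * O) * E := by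
          simp only [transpose_mul, hEt, hRt, transpose_transpose, mul_assoc]
      _ = J ι ℝ * (E * D * E) := by
        have hEJ : E * J ι ℝ = J ι ℝ * E := (J_mul_diagonal _).symm
        rw [hK, ← mul_assoc E, hEJ]
        simp only [mul_assoc]
        rfl
      _ = J ι ℝ := by rw [hEDE, mul_one]
  · calc (E * Oᵀ * R)ᵀ * D * (E * Oᵀ * R) = R * (O * (E * D * E) * Oᵀ) * R := by
          simp only [transpose_mul, hEt, hRt, transpose_transpose, mul_assoc]
      _ = R * R := by rw [hEDE, mul_one, mul_eq_one_comm.1 hO, mul_one]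

end Williamson

section SymplecticSpectrum

variable {ι : Type*} [Fintype ι] [DecidableEq ι]

theorem transpose_mul_J_mul {S : Matrix (ι ⊕ ι) (ι ⊕ ι) ℝ} (hS : S ∈ symplecticGroup ι ℝ) :
    Sᵀ * J ι ℝ * S = J ι ℝ :=
  SymplecticGroup.mem_iff'.1 hS

theorem inv_mem_symplecticGroup {S : Matrix (ι ⊕ ι) (ι ⊕ ι) ℝ} (hS : S ∈ symplecticGroup ι ℝ) :
    S⁻¹ ∈ symplecticGroup ι ℝ := by
  rw [← SymplecticGroup.coe_inv' ⟨_, hS⟩]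
  exact SetLike.coe_mem _

theorem map_ofReal_mul {n : Type*} [Fintype n] (A B : Matrix n n ℝ) :
    (A * B).map Complex.ofReal = A.map Complex.ofReal * B.map Complex.ofReal :=
  Matrix.map_mul (f := Complex.ofRealHom)

theorem symplecticEigenvalues_congr {S : Matrix (ι ⊕ ι) (ι ⊕ ι) ℝ} (hS : S ∈ symplecticGroup ι ℝ)
    (M : Matrix (ι ⊕ ι) (ι ⊕ ι) ℝ) :
    symplecticEigenvalues (Sᵀ * M * S) = symplecticEigenvalues M := by
  have h : S * (-J ι ℝ * (Sᵀ * M)) = -J ι ℝ * M := by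
    rw [neg_mul, mul_neg, neg_mul, ← mul_assoc, ← mul_assoc, SymplecticGroup.mem_iff.1 hS]
  rw [symplecticEigenvalues, symplecticEigenvalues, ← mul_assoc, map_ofReal_mul, ← smul_mul_assoc,
    charpoly_mul_comm, mul_smul_comm, ← map_ofReal_mul, h]

theorem symplecticEigenvalues_diagonal {ν : ι → ℝ} (hν : ∀ k, 0 < ν k) :
    symplecticEigenvalues (diagonal (Sum.elim ν ν)) = Finset.univ.val.map ν := by
  let μ : ι → ℂ := fun k => ν k
  let P : Matrix (ι ⊕ ι) (ι ⊕ ι) ℂ := fromBlocks 1 1 (-(Complex.I • 1)) (Complex.I • 1)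
  let Q : Matrix (ι ⊕ ι) (ι ⊕ ι) ℂ := fromBlocks 1 (Complex.I • 1) 1 (-(Complex.I • 1))
  have hΩ : Complex.I • (-J ι ℝ * diagonal (Sum.elim ν ν)).map Complex.ofReal =
      P * diagonal (Sum.elim μ (-μ)) * ((1 / 2 : ℂ) • Q) := by
    simp only [J, P, Q, ← fromBlocks_diagonal, fromBlocks_neg, fromBlocks_multiply, fromBlocks_map,
      fromBlocks_smul]
    congr 1 <;> ext i j <;> by_cases hij : i = j <;>
      simp [hij, μ, ← two_mul]
  have hQP : (1 / 2 : ℂ) • Q * P = 1 := by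
    simp only [P, Q, fromBlocks_smul, fromBlocks_multiply]
    rw [← fromBlocks_one]
    congr 1 <;> ext i j <;> by_cases hij : i = j <;>
      simp [hij, one_apply, mul_left_comm Complex.I, ← two_mul]
  rw [symplecticEigenvalues, hΩ, mul_assoc, charpoly_mul_comm, mul_assoc, hQP, mul_one,
    roots_charpoly_diagonal, Multiset.map_map, ← Finset.univ_disjSum_univ, Finset.val_disjSum,
    Multiset.disjSum, Multiset.map_add, Multiset.filter_add, Multiset.map_map, Multiset.map_map,
    Multiset.filter_eq_self.2, Multiset.filter_eq_nil.2, add_zero]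
  · exact Multiset.map_congr rfl fun k _ => Complex.ofReal_re _
  · simpa [μ] using fun k => (hν k).le
  · simpa [μ] using hν

theorem symplecticEigenvalues_of_diagonalization {M T : Matrix (ι ⊕ ι) (ι ⊕ ι) ℝ} {ν : ι → ℝ}
    (hT : T ∈ symplecticGroup ι ℝ) (hν : ∀ k, 0 < ν k)
    (h : Tᵀ * diagonal (Sum.elim ν ν) * T = M) :
    symplecticEigenvalues M = Finset.univ.val.map ν := by
  rw [← h, symplecticEigenvalues_congr hT, symplecticEigenvalues_diagonal hν]

theorem card_symplecticEigenvalues {M : Matrix (ι ⊕ ι) (ι ⊕ ι) ℝ} (hM : M.PosDef) :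
    (symplecticEigenvalues M).card = Fintype.card ι := by
  obtain ⟨T, hT, ν, hν, h⟩ := exists_symplectic_diagonalization hM
  rw [symplecticEigenvalues_of_diagonalization hT hν h, Multiset.card_map]
  rfl

theorem two_le_row_inl_add_row_inr {T : Matrix (ι ⊕ ι) (ι ⊕ ι) ℝ} (hT : T ∈ symplecticGroup ι ℝ)
    (k : ι) : 2 ≤ T (Sum.inl k) ⬝ᵥ T (Sum.inl k) + T (Sum.inr k) ⬝ᵥ T (Sum.inr k) := by
  set x := T (Sum.inl k)
  set y := T (Sum.inr k)
  have hxy : x ⬝ᵥ J ι ℝ *ᵥ y = -1 := by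
    have h := congrFun (congrFun (SymplecticGroup.mem_iff.1 hT) (Sum.inl k)) (Sum.inr k)
    rw [mul_assoc] at h
    exact h.trans (by simp [J])
  have hJJ : (J ι ℝ *ᵥ y) ⬝ᵥ (J ι ℝ *ᵥ y) = y ⬝ᵥ y := by
    rw [dotProduct_mulVec, ← mulVec_transpose, mulVec_mulVec, J_transpose, neg_mul, J_squared,
      neg_neg, one_mulVec]
  have h0 : 0 ≤ (x + J ι ℝ *ᵥ y) ⬝ᵥ (x + J ι ℝ *ᵥ y) := by
    simpa using dotProduct_star_self_nonneg (x + J ι ℝ *ᵥ y)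
  rw [add_dotProduct, dotProduct_add, dotProduct_add, hJJ, dotProduct_comm (J ι ℝ *ᵥ y), hxy] at h0
  linarith

theorem two_mul_sum_symplecticEigenvalues_le_trace {M : Matrix (ι ⊕ ι) (ι ⊕ ι) ℝ}
    (hM : M.PosDef) : 2 * (symplecticEigenvalues M).sum ≤ M.trace := by
  obtain ⟨T, hT, ν, hν, h⟩ := exists_symplectic_diagonalization hM
  have htr : M.trace = ∑ k, ν k *
      (T (Sum.inl k) ⬝ᵥ T (Sum.inl k) + T (Sum.inr k) ⬝ᵥ T (Sum.inr k)) := by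
    rw [← h, mul_assoc, trace_mul_comm, mul_assoc, trace]
    simp only [diag_apply, diagonal_mul, Fintype.sum_sum_type, mul_add, Finset.sum_add_distrib]
    rfl
  rw [htr, symplecticEigenvalues_of_diagonalization hT hν h, mul_comm]
  change (∑ k, ν k) * 2 ≤ _
  rw [Finset.sum_mul]
  exact Finset.sum_le_sum fun k _ =>
    mul_le_mul_of_nonneg_left (two_le_row_inl_add_row_inr hT k) (hν k).le

end SymplecticSpectrum

section LowerSymplectic

variable {ι : Type*} [Fintype ι] [DecidableEq ι]

/-- The symplectic block lower triangular matrices `[[B, 0], [C B, B⁻ᵀ]]`; they describe a chirp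
followed by a linear change of variables. -/
def lowerSymplectic (B C : Matrix ι ι ℝ) : Matrix (ι ⊕ ι) (ι ⊕ ι) ℝ :=
  fromBlocks B 0 (C * B) (B⁻¹)ᵀ

theorem lowerSymplectic_mem {B C : Matrix ι ι ℝ} (hB : B.det ≠ 0) (hC : Cᵀ = C) :
    lowerSymplectic B C ∈ symplecticGroup ι ℝ := by
  rw [lowerSymplectic, SymplecticGroup.fromBlocks_mem_iff]
  refine ⟨?_, by simp, ?_⟩
  · rw [transpose_mul, hC, mul_assoc]
  · rw [← transpose_mul, nonsing_inv_mul _ hB.isUnit]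
    simp

theorem eq_of_fromBlocks_mem_symplecticGroup {P Q R T T' : Matrix ι ι ℝ} (hP : IsUnit Pᵀ.det)
    (h : fromBlocks P Q R T ∈ symplecticGroup ι ℝ)
    (h' : fromBlocks P Q R T' ∈ symplecticGroup ι ℝ) : T = T' := by
  have e := (SymplecticGroup.fromBlocks_mem_iff.1 h).2.2
  have e' := (SymplecticGroup.fromBlocks_mem_iff.1 h').2.2
  exact mul_right_injective_of_inv _ _ (nonsing_inv_mul _ hP) (sub_left_injective (e.trans e'.symm))

theorem exists_lowerSymplectic_mul_transpose_eq {G : Matrix (ι ⊕ ι) (ι ⊕ ι) ℝ} (hG : G.PosDef)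
    (hmem : G ∈ symplecticGroup ι ℝ) :
    ∃ B C : Matrix ι ι ℝ, B.det ≠ 0 ∧ Cᵀ = C ∧
      lowerSymplectic B C * (lowerSymplectic B C)ᵀ = G := by
  obtain ⟨P, Q, R, T, rfl⟩ : ∃ P Q R T, G = fromBlocks P Q R T :=
    ⟨_, _, _, _, (fromBlocks_toBlocks G).symm⟩
  have hGt := transpose_eq_of_posDef hG
  rw [fromBlocks_transpose, fromBlocks_inj] at hGt
  obtain ⟨hP, hR, hQ, -⟩ := hGt
  have hPpos : P.PosDef := hG.submatrix Sum.inl_injective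
  have hPu : IsUnit P.det := hPpos.det_pos.ne'.isUnit
  obtain ⟨B, hB, hBB⟩ := exists_posDef_sqrt hPpos
  have hBt := transpose_eq_of_posDef hB
  have hBu : IsUnit B.det := hB.det_pos.ne'.isUnit
  have hPR : P * R = Q * P := by
    simpa only [hP, hR] using (SymplecticGroup.fromBlocks_mem_iff.1 hmem).1
  have hC : (P⁻¹ * Q)ᵀ = P⁻¹ * Q := by
    calc (P⁻¹ * Q)ᵀ = R * P⁻¹ := by rw [transpose_mul, transpose_nonsing_inv, hP, hQ]
      _ = P⁻¹ * (P * R) * P⁻¹ := by rw [nonsing_inv_mul_cancel_left _ _ hPu]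
      _ = P⁻¹ * Q := by rw [hPR, ← mul_assoc, mul_nonsing_inv_cancel_right _ _ hPu]
  have hL := lowerSymplectic_mem hBu.ne_zero hC
  have hLL : lowerSymplectic B (P⁻¹ * Q) * (lowerSymplectic B (P⁻¹ * Q))ᵀ =
      fromBlocks P Q R (P⁻¹ * Q * B * (B * (P⁻¹ * Q)) + B⁻¹ᵀ * B⁻¹) := by
    rw [lowerSymplectic, fromBlocks_transpose, fromBlocks_multiply, transpose_mul, hC, hBt,
      transpose_zero, zero_mul, zero_mul, mul_zero, add_zero, add_zero, add_zero,
      mul_assoc (P⁻¹ * Q) B B, ← mul_assoc B B, hBB, mul_nonsing_inv_cancel_left _ _ hPu,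
      mul_assoc P⁻¹ Q P, ← hPR, nonsing_inv_mul_cancel_left _ _ hPu, transpose_transpose]
  have hmem' := mul_mem hL (SymplecticGroup.transpose_mem hL)
  rw [hLL] at hmem'
  refine ⟨B, P⁻¹ * Q, hBu.ne_zero, hC, ?_⟩
  rw [hLL, eq_of_fromBlocks_mem_symplecticGroup (by rwa [hP]) hmem' hmem]

theorem exists_trace_lowerSymplectic_congr {M : Matrix (ι ⊕ ι) (ι ⊕ ι) ℝ} (hM : M.PosDef) :
    ∃ B C : Matrix ι ι ℝ, B.det ≠ 0 ∧ Cᵀ = C ∧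
      ((lowerSymplectic B C)ᵀ * M * lowerSymplectic B C).trace =
        2 * (symplecticEigenvalues M).sum := by
  obtain ⟨T, hT, ν, hν, h⟩ := exists_symplectic_diagonalization hM
  have hu : IsUnit T.det := SymplecticGroup.symplectic_det hT
  have hS := inv_mem_symplecticGroup hT
  have hSS : (T⁻¹ * T⁻¹ᵀ).PosDef := by
    rw [← conjTranspose_eq_transpose_of_trivial]
    exact PosDef.mul_conjTranspose_self _
      (vecMul_injective_of_isUnit ((isUnit_iff_isUnit_det _).2 (isUnit_nonsing_inv_det _ hu)))
  obtain ⟨B, C, hB, hC, hL⟩ := exists_lowerSymplectic_mul_transpose_eq hSS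
    (mul_mem hS (SymplecticGroup.transpose_mem hS))
  refine ⟨B, C, hB, hC, ?_⟩
  calc ((lowerSymplectic B C)ᵀ * M * lowerSymplectic B C).trace = (M * (T⁻¹ * T⁻¹ᵀ)).trace := by
        rw [mul_assoc, trace_mul_comm, mul_assoc, hL]
    _ = (diagonal (Sum.elim ν ν)).trace := by
        have hTT : T * (T⁻¹ * T⁻¹ᵀ) = T⁻¹ᵀ := mul_nonsing_inv_cancel_left _ _ hu
        have hTT' : T⁻¹ᵀ * Tᵀ = 1 := by rw [← transpose_mul, mul_nonsing_inv _ hu, transpose_one]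
        rw [← h, mul_assoc, hTT, trace_mul_comm, ← mul_assoc, hTT', one_mul]
    _ = 2 * (symplecticEigenvalues M).sum := by
        rw [symplecticEigenvalues_of_diagonalization hT hν h, trace_diagonal, Fintype.sum_sum_type,
          two_mul]
        rfl

end LowerSymplectic

section PureCovariance

variable {ι : Type*} [Fintype ι] [DecidableEq ι]

/-- A pure covariance matrix, that is, one whose symplectic eigenvalues are all equal to one: it is
the image of the identity under a symplectic congruence. -/
def IsPureCovariance (M : Matrix (ι ⊕ ι) (ι ⊕ ι) ℝ) : Prop :=
  ∃ T ∈ symplecticGroup ι ℝ, Tᵀ * T = M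

theorem mulVec_dotProduct_mulVec_mulVec {m n : Type*} [Fintype m] [Fintype n] (S : Matrix m n ℝ)
    (M : Matrix m m ℝ) (x y : n → ℝ) :
    (S *ᵥ x) ⬝ᵥ (M *ᵥ (S *ᵥ y)) = x ⬝ᵥ ((Sᵀ * M * S) *ᵥ y) := by
  rw [Matrix.mul_assoc, ← mulVec_mulVec, ← mulVec_mulVec, dotProduct_mulVec x, vecMul_transpose]

theorem isPureCovariance_of_uncertainty {M : Matrix (ι ⊕ ι) (ι ⊕ ι) ℝ} (hM : M.PosDef)
    (hunc : ∀ ξ η, 2 * (ξ ⬝ᵥ J ι ℝ *ᵥ η) ≤ ξ ⬝ᵥ M *ᵥ ξ + η ⬝ᵥ M *ᵥ η) (hdet : M.det = 1) :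
    IsPureCovariance M := by
  obtain ⟨T, hT, ν, hν, h⟩ := exists_symplectic_diagonalization hM
  have hu : IsUnit T.det := SymplecticGroup.symplectic_det hT
  have hD : T⁻¹ᵀ * M * T⁻¹ = diagonal (Sum.elim ν ν) := by
    rw [← h, mul_assoc, mul_nonsing_inv_cancel_right _ _ hu, ← mul_assoc, ← transpose_mul,
      mul_nonsing_inv _ hu, transpose_one, one_mul]
  have hge (k : ι) : 1 ≤ ν k := by
    have h := hunc (T⁻¹ *ᵥ Pi.single (Sum.inr k) 1) (T⁻¹ *ᵥ Pi.single (Sum.inl k) 1)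
    simp only [mulVec_dotProduct_mulVec_mulVec, hD,
      transpose_mul_J_mul (inv_mem_symplecticGroup hT)] at h
    simp only [J, single_dotProduct, mulVec_single, MulOpposite.op_one, one_smul, mul_one, one_mul,
      col_apply, fromBlocks_apply₂₁, one_apply_eq, diagonal_apply_eq, Sum.elim_inl,
      Sum.elim_inr] at h
    linarith
  have hprod : ∏ k, ν k = 1 := by
    have hsq : (∏ k, ν k) * ∏ k, ν k = 1 := by
      rw [← hdet, ← h, det_mul, det_mul, det_transpose, SymplecticGroup.det_eq_one hT, det_diagonal,
        Fintype.prod_sum_type]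
      simp
    nlinarith [Finset.one_le_prod (s := Finset.univ) fun k _ => hge k]
  have hone (k : ι) : ν k = 1 := by
    refine le_antisymm ?_ (hge k)
    calc ν k ≤ ν k * ∏ l ∈ Finset.univ.erase k, ν l :=
          le_mul_of_one_le_right (hν k).le (Finset.one_le_prod fun l _ => hge l)
      _ = 1 := by rw [Finset.mul_prod_erase _ _ (Finset.mem_univ k), hprod]
  refine ⟨T, hT, ?_⟩
  rw [← h, funext hone]
  simp

theorem IsPureCovariance.posDef {M : Matrix (ι ⊕ ι) (ι ⊕ ι) ℝ} (hM : IsPureCovariance M) :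
    M.PosDef := by
  obtain ⟨T, hT, rfl⟩ := hM
  rw [← conjTranspose_eq_transpose_of_trivial]
  exact PosDef.conjTranspose_mul_self _
    (mulVec_injective_of_isUnit ((isUnit_iff_isUnit_det _).2 (SymplecticGroup.symplectic_det hT)))

theorem IsPureCovariance.sum_symplecticEigenvalues {M : Matrix (ι ⊕ ι) (ι ⊕ ι) ℝ}
    (hM : IsPureCovariance M) : (symplecticEigenvalues M).sum = Fintype.card ι := by
  obtain ⟨T, hT, rfl⟩ := hM
  rw [symplecticEigenvalues_of_diagonalization (ν := 1) hT (fun _ => one_pos)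
    (by rw [show Sum.elim (1 : ι → ℝ) 1 = 1 from Sum.elim_one_one, diagonal_one', mul_one])]
  simp

theorem J_mul_congr {T : Matrix (ι ⊕ ι) (ι ⊕ ι) ℝ} (hT : T ∈ symplecticGroup ι ℝ)
    (D : Matrix (ι ⊕ ι) (ι ⊕ ι) ℝ) : J ι ℝ * (Tᵀ * D * T) = T⁻¹ * (J ι ℝ * D) * T := by
  have h : T⁻¹ * J ι ℝ = J ι ℝ * Tᵀ := by
    conv_lhs => rw [← SymplecticGroup.mem_iff.1 hT, mul_assoc T,
      nonsing_inv_mul_cancel_left _ _ (SymplecticGroup.symplectic_det hT)]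
  simp only [← mul_assoc, h]

theorem J_mul_congr_sq {T : Matrix (ι ⊕ ι) (ι ⊕ ι) ℝ} (hT : T ∈ symplecticGroup ι ℝ)
    (D : Matrix (ι ⊕ ι) (ι ⊕ ι) ℝ) :
    J ι ℝ * (Tᵀ * D * T) * (J ι ℝ * (Tᵀ * D * T)) = T⁻¹ * (J ι ℝ * D * (J ι ℝ * D)) * T := by
  rw [J_mul_congr hT, ← mul_assoc, ← mul_assoc,
    mul_nonsing_inv_cancel_right _ _ (SymplecticGroup.symplectic_det hT), mul_assoc T⁻¹]

theorem IsPureCovariance.J_mul_sq {M : Matrix (ι ⊕ ι) (ι ⊕ ι) ℝ} (hM : IsPureCovariance M) :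
    J ι ℝ * M * (J ι ℝ * M) = -1 := by
  obtain ⟨T, hT, rfl⟩ := hM
  have h := J_mul_congr_sq hT 1
  rwa [mul_one, mul_one, J_squared, mul_neg_one, neg_mul,
    nonsing_inv_mul _ (SymplecticGroup.symplectic_det hT)] at h

theorem roots_charpoly_one_add_J_mul_sq {M T : Matrix (ι ⊕ ι) (ι ⊕ ι) ℝ} {ν : ι → ℝ}
    (hT : T ∈ symplecticGroup ι ℝ) (h : Tᵀ * diagonal (Sum.elim ν ν) * T = M) :
    (1 + J ι ℝ * M * (J ι ℝ * M)).charpoly.roots =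
      Finset.univ.val.map fun s => 1 - Sum.elim ν ν s ^ 2 := by
  have hu : IsUnit T.det := SymplecticGroup.symplectic_det hT
  have hsq : J ι ℝ * diagonal (Sum.elim ν ν) * (J ι ℝ * diagonal (Sum.elim ν ν)) =
      -diagonal fun s => Sum.elim ν ν s ^ 2 := by
    nth_rw 1 [J_mul_diagonal]
    rw [mul_assoc, ← mul_assoc (J ι ℝ), J_squared, neg_one_mul, mul_neg, diagonal_mul_diagonal]
    simp only [sq]
  have hconj : 1 + J ι ℝ * M * (J ι ℝ * M) =
      T⁻¹ * diagonal (fun s => 1 - Sum.elim ν ν s ^ 2) * T := by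
    rw [← h, J_mul_congr_sq hT, hsq, ← diagonal_sub, diagonal_one, mul_sub, sub_mul, mul_one,
      nonsing_inv_mul _ hu, mul_neg, neg_mul, sub_eq_add_neg]
  rw [hconj, mul_assoc, charpoly_mul_comm, mul_nonsing_inv_cancel_right _ _ hu,
    roots_charpoly_diagonal]

theorem two_mul_sum_sub_one {M : Matrix (ι ⊕ ι) (ι ⊕ ι) ℝ} (hM : M.PosDef) :
    2 * ((symplecticEigenvalues M).map fun ν => ν - 1).sum =
      ((1 + J ι ℝ * M * (J ι ℝ * M)).charpoly.roots.map fun z => √(1 - z) - 1).sum := by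
  obtain ⟨T, hT, ν, hν, h⟩ := exists_symplectic_diagonalization hM
  rw [symplecticEigenvalues_of_diagonalization hT hν h, roots_charpoly_one_add_J_mul_sq hT h,
    Multiset.map_map, Multiset.map_map]
  change 2 * ∑ k, (ν k - 1) = ∑ s, (√(1 - (1 - Sum.elim ν ν s ^ 2)) - 1)
  simp only [Fintype.sum_sum_type, Sum.elim_inl, Sum.elim_inr, sub_sub_cancel, two_mul,
    fun k => Real.sqrt_sq (hν k).le]

theorem sum_roots_charpoly_mul_comm {R β m n : Type*} [CommRing R] [IsDomain R] [AddCommMonoid β]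
    [Fintype m] [Fintype n] [DecidableEq m] [DecidableEq n] (P : Matrix m n R) (Q : Matrix n m R)
    {g : R → β} (hg : g 0 = 0) :
    ((P * Q).charpoly.roots.map g).sum = ((Q * P).charpoly.roots.map g).sum := by
  have hne (k : ℕ) {p : Polynomial R} (hp : p.Monic) : Polynomial.X ^ k * p ≠ 0 :=
    ((Polynomial.monic_X_pow k).mul hp).ne_zero
  have h := congrArg Polynomial.roots (charpoly_mul_comm' P Q)
  rw [Polynomial.roots_mul (hne _ (charpoly_monic _)),
    Polynomial.roots_mul (hne _ (charpoly_monic _)), Polynomial.roots_X_pow,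
    Polynomial.roots_X_pow] at h
  simpa [hg, Multiset.map_nsmul, Multiset.sum_nsmul] using
    congrArg (fun s : Multiset R => (s.map g).sum) h

/-- The index map of the phase space of the modes in `A`. -/
abbrev blockIncl {ι : Type*} (A : Finset ι) : A ⊕ A → ι ⊕ ι := Sum.map Subtype.val Subtype.val

theorem blockIncl_injective {ι : Type*} (A : Finset ι) : Function.Injective (blockIncl A) :=
  Subtype.val_injective.sumMap Subtype.val_injective

theorem posDef_block {ι : Type*} {M : Matrix (ι ⊕ ι) (ι ⊕ ι) ℝ} (hM : M.PosDef) (A : Finset ι) :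
    (M.submatrix (blockIncl A) (blockIncl A)).PosDef :=
  hM.submatrix (blockIncl_injective A)

theorem sum_phaseSpace_split {R : Type*} [AddCommMonoid R] (A : Finset ι) (f : ι ⊕ ι → R) :
    ∑ k, f k = ∑ a, f (blockIncl A a) + ∑ b, f (blockIncl Aᶜ b) := by
  have h (g : ι → R) : ∑ i, g i = ∑ i : A, g i + ∑ i : (Aᶜ : Finset ι), g i := by
    rw [Finset.sum_coe_sort A g, Finset.sum_coe_sort Aᶜ g, Finset.sum_add_sum_compl]
  simp only [Fintype.sum_sum_type, blockIncl, Sum.map_inl, Sum.map_inr, h fun i => f (Sum.inl i),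
    h fun i => f (Sum.inr i)]
  abel

theorem J_mul_submatrix (A : Finset ι) (M : Matrix (ι ⊕ ι) (ι ⊕ ι) ℝ) {α : Type*}
    (e : α → ι ⊕ ι) :
    (J ι ℝ * M).submatrix (blockIncl A) e = J A ℝ * M.submatrix (blockIncl A) e := by
  ext (s | s) t <;> simp [J, mul_apply, Fintype.sum_sum_type, one_apply]

theorem one_add_block_sq {K : Matrix (ι ⊕ ι) (ι ⊕ ι) ℝ} (hK : K * K = -1) (A : Finset ι) :
    1 + K.submatrix (blockIncl A) (blockIncl A) * K.submatrix (blockIncl A) (blockIncl A) =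
      -(K.submatrix (blockIncl A) (blockIncl Aᶜ) * K.submatrix (blockIncl Aᶜ) (blockIncl A)) := by
  ext s t
  have h := congrFun (congrFun hK (blockIncl A s)) (blockIncl A t)
  rw [mul_apply, sum_phaseSpace_split A] at h
  simp only [Matrix.neg_apply, one_apply, (blockIncl_injective A).eq_iff] at h
  simp only [Matrix.add_apply, one_apply, mul_apply, Matrix.neg_apply, submatrix_apply]
  linarith

-- Since `1 + K_AA² = -K_AB K_BA` for `K = J M` and `B = Aᶜ`, the symplectic spectra of the two
-- blocks agree up to eigenvalues equal to one.
theorem IsPureCovariance.sum_sub_one_compl {M : Matrix (ι ⊕ ι) (ι ⊕ ι) ℝ}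
    (hM : IsPureCovariance M) (A : Finset ι) :
    ((symplecticEigenvalues (M.submatrix (blockIncl Aᶜ) (blockIncl Aᶜ))).map
        fun ν => ν - 1).sum =
      ((symplecticEigenvalues (M.submatrix (blockIncl A) (blockIncl A))).map
        fun ν => ν - 1).sum := by
  refine mul_left_cancel₀ (two_ne_zero (α := ℝ)) ?_
  rw [two_mul_sum_sub_one (posDef_block hM.posDef A),
    two_mul_sum_sub_one (posDef_block hM.posDef Aᶜ), ← J_mul_submatrix, ← J_mul_submatrix,
    one_add_block_sq hM.J_mul_sq, one_add_block_sq hM.J_mul_sq, compl_compl,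
    ← Matrix.neg_mul, ← Matrix.mul_neg]
  exact sum_roots_charpoly_mul_comm _ _ (by simp)

end PureCovariance

section WeightedComposition

variable {α : Type*} [MeasurableSpace α]

/-- The weighted composition operator `f ↦ u · (f ∘ T)` is well defined and isometric on
`L²(μ)`. All concrete unitaries below are of this form. -/
structure IsIsometricWeightedComp (u : α → ℂ) (T : α → α) (μ : Measure α) : Prop where
  measurable : Measurable u
  quasiMeasurePreserving : μ.QuasiMeasurePreserving T μ
  eLpNorm_eq : ∀ {f : α → ℂ}, AEStronglyMeasurable f μ →
    eLpNorm (fun x => u x * f (T x)) 2 μ = eLpNorm f 2 μ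

namespace IsIsometricWeightedComp

variable {μ : Measure α} {u u' : α → ℂ} {T T' : α → α}

theorem memLp (h : IsIsometricWeightedComp u T μ) (f : Lp ℂ 2 μ) :
    MemLp (fun x => u x * f (T x)) 2 μ :=
  ⟨h.measurable.aestronglyMeasurable.mul
      ((Lp.memLp f).1.comp_quasiMeasurePreserving h.quasiMeasurePreserving),
    (h.eLpNorm_eq (Lp.memLp f).1).trans_lt (Lp.memLp f).2⟩

theorem ae_congr (h : IsIsometricWeightedComp u T μ) {f g : α → ℂ} (hfg : f =ᵐ[μ] g) :
    (fun x => u x * f (T x)) =ᵐ[μ] fun x => u x * g (T x) :=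
  Filter.EventuallyEq.mul .rfl (h.quasiMeasurePreserving.ae_eq_comp hfg)

/-- The isometry `f ↦ u · (f ∘ T)` of `L²(μ)`. -/
def toLinearIsometry (h : IsIsometricWeightedComp u T μ) : Lp ℂ 2 μ →ₗᵢ[ℂ] Lp ℂ 2 μ where
  toFun f := (h.memLp f).toLp _
  map_add' f g := by
    rw [← MemLp.toLp_add (h.memLp f) (h.memLp g)]
    refine MemLp.toLp_congr _ _ ((h.ae_congr (Lp.coeFn_add f g)).trans (.of_forall fun x => ?_))
    simp only [Pi.add_apply, mul_add]
  map_smul' c f := by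
    rw [RingHom.id_apply, ← MemLp.toLp_const_smul c (h.memLp f)]
    refine MemLp.toLp_congr _ _ ((h.ae_congr (Lp.coeFn_smul c f)).trans (.of_forall fun x => ?_))
    simp only [Pi.smul_apply, smul_eq_mul, mul_left_comm]
  norm_map' f := by
    simp only [LinearMap.coe_mk, AddHom.coe_mk]
    rw [Lp.norm_toLp, h.eLpNorm_eq (Lp.memLp f).1, Lp.norm_def]

theorem coeFn_toLinearIsometry (h : IsIsometricWeightedComp u T μ) {f : Lp ℂ 2 μ} {g : α → ℂ}
    (hg : f =ᵐ[μ] g) : h.toLinearIsometry f =ᵐ[μ] fun x => u x * g (T x) :=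
  (h.memLp f).coeFn_toLp.trans (h.ae_congr hg)

/-- The unitary `f ↦ u · (f ∘ T)` of `L²(μ)`, for `u` and `T` invertible. -/
def toLinearIsometryEquiv (h : IsIsometricWeightedComp u T μ)
    (h' : IsIsometricWeightedComp u' T' μ) (hu : ∀ x, u x * u' (T x) = 1)
    (hT : ∀ x, T' (T x) = x) : Lp ℂ 2 μ ≃ₗᵢ[ℂ] Lp ℂ 2 μ :=
  LinearIsometryEquiv.ofSurjective h.toLinearIsometry fun f => ⟨h'.toLinearIsometry f, by
    refine Lp.ext ((h.coeFn_toLinearIsometry (h'.coeFn_toLinearIsometry .rfl)).trans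
      (.of_forall fun x => ?_))
    simp only [hT, ← mul_assoc, hu, one_mul]⟩

theorem of_measurePreserving (hu : Measurable u) (hu1 : ∀ x, ‖u x‖ = 1)
    (hT : MeasurePreserving T μ μ) : IsIsometricWeightedComp u T μ where
  measurable := hu
  quasiMeasurePreserving := hT.quasiMeasurePreserving
  eLpNorm_eq {f} hf := by
    rw [← eLpNorm_comp_measurePreserving hf hT]
    exact eLpNorm_congr_norm_ae (.of_forall fun x => by simp [hu1])

theorem of_matrix {ι : Type*} [Fintype ι] [DecidableEq ι] {A : Matrix ι ι ℝ} (hA : A.det ≠ 0) :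
    IsIsometricWeightedComp (fun _ => ((√|A.det| : ℝ) : ℂ)) (A *ᵥ ·) volume := by
  have hm : Measurable (A *ᵥ ·) := (LinearMap.continuous_of_finiteDimensional (toLin' A)).measurable
  have hmap : Measure.map (A *ᵥ ·) volume =
      ENNReal.ofReal |A.det⁻¹| • (volume : Measure (ι → ℝ)) :=
    Real.map_matrix_volume_pi_eq_smul_volume_pi hA
  have hac : Measure.map (A *ᵥ ·) volume ≪ (volume : Measure (ι → ℝ)) :=
    hmap ▸ Measure.smul_absolutelyContinuous
  refine ⟨measurable_const, ⟨hm, hac⟩, fun {f} hf => ?_⟩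
  change eLpNorm (((√|A.det| : ℝ) : ℂ) • (f ∘ (A *ᵥ ·))) 2 volume = _
  rw [eLpNorm_const_smul, ← eLpNorm_map_measure (hf.mono_ac hac) hm.aemeasurable, hmap,
    eLpNorm_smul_measure_of_ne_top ENNReal.ofNat_ne_top, smul_eq_mul, ← mul_assoc]
  have hone :
      ‖((√|A.det| : ℝ) : ℂ)‖ₑ * ENNReal.ofReal |A.det⁻¹| ^ (1 / 2 : ENNReal).toReal = 1 := by
    rw [← ofReal_norm, Complex.norm_real, Real.norm_of_nonneg (Real.sqrt_nonneg _),
      ENNReal.ofReal_rpow_of_nonneg (abs_nonneg _) ENNReal.toReal_nonneg,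
      ← ENNReal.ofReal_mul (Real.sqrt_nonneg _), ENNReal.toReal_div, ENNReal.toReal_one,
      ENNReal.toReal_ofNat, ← Real.sqrt_eq_rpow, ← Real.sqrt_mul (abs_nonneg _), ← abs_mul,
      mul_inv_cancel₀ hA, abs_one, Real.sqrt_one, ENNReal.ofReal_one]
  rw [hone, one_mul]

end IsIsometricWeightedComp

end WeightedComposition

section Weyl

variable {ι : Type*} [Fintype ι]

theorem exp_I_mul_ofReal_add (a b : ℝ) : Complex.exp (Complex.I * ((a + b : ℝ) : ℂ)) =
    Complex.exp (Complex.I * (a : ℂ)) * Complex.exp (Complex.I * (b : ℂ)) := by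
  rw [Complex.ofReal_add, mul_add, Complex.exp_add]

/-- The multiplier `exp (i (b·x - a·b/2))`, `ξ = (a, b)`, of the Weyl operator. -/
def weylPhase (ξ : ι ⊕ ι → ℝ) (x : ι → ℝ) : ℂ :=
  Complex.exp (Complex.I *
    (((ξ ∘ Sum.inr) ⬝ᵥ x - (ξ ∘ Sum.inl) ⬝ᵥ (ξ ∘ Sum.inr) / 2 : ℝ) : ℂ))

theorem isIsometricWeightedComp_weyl (ξ : ι ⊕ ι → ℝ) :
    IsIsometricWeightedComp (weylPhase ξ) (fun x => x - ξ ∘ Sum.inl) volume :=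
  .of_measurePreserving
    (Continuous.measurable (by unfold weylPhase dotProduct; fun_prop))
    (fun _ => Complex.norm_exp_I_mul_ofReal _) (measurePreserving_sub_right volume _)

theorem coeFn_weyl (ξ : ι ⊕ ι → ℝ) {f : Modes ι} {g : (ι → ℝ) → ℂ} (hg : f =ᵐ[volume] g) :
    weyl ξ f =ᵐ[volume] fun x => weylPhase ξ x * g (x - ξ ∘ Sum.inl) :=
  (isIsometricWeightedComp_weyl ξ).coeFn_toLinearIsometry hg

theorem weyl_zero (f : Modes ι) : weyl 0 f = f :=
  Lp.ext ((coeFn_weyl 0 .rfl).trans (.of_forall fun x => by simp [weylPhase, Pi.zero_comp]))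

/-- The symplectic form on phase space. -/
def sympForm (ξ η : ι ⊕ ι → ℝ) : ℝ :=
  (ξ ∘ Sum.inr) ⬝ᵥ (η ∘ Sum.inl) - (ξ ∘ Sum.inl) ⬝ᵥ (η ∘ Sum.inr)

theorem sympForm_eq [DecidableEq ι] (ξ η : ι ⊕ ι → ℝ) : sympForm ξ η = ξ ⬝ᵥ J ι ℝ *ᵥ η := by
  obtain ⟨a, b, rfl⟩ : ∃ a b, ξ = Sum.elim a b := ⟨_, _, (Sum.elim_comp_inl_inr ξ).symm⟩
  rw [J, fromBlocks_mulVec, sumElim_dotProduct_sumElim]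
  simp only [sympForm, Sum.elim_comp_inl, Sum.elim_comp_inr, neg_mulVec, one_mulVec, zero_mulVec,
    dotProduct_neg, zero_add, add_zero]
  ring

theorem sympForm_comm (ξ η : ι ⊕ ι → ℝ) : sympForm ξ η = -sympForm η ξ := by
  rw [sympForm, sympForm, neg_sub, dotProduct_comm, dotProduct_comm (ξ ∘ Sum.inl)]

theorem sympForm_self (ξ : ι ⊕ ι → ℝ) : sympForm ξ ξ = 0 :=
  sub_eq_zero_of_eq (dotProduct_comm _ _)

theorem sympForm_neg_left (ξ η : ι ⊕ ι → ℝ) : sympForm (-ξ) η = -sympForm ξ η := by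
  simp only [sympForm, Pi.neg_comp, neg_dotProduct]
  ring

theorem sympForm_smul_smul (s t : ℝ) (ξ η : ι ⊕ ι → ℝ) :
    sympForm (s • ξ) (t • η) = s * t * sympForm ξ η := by
  simp only [sympForm, Pi.smul_comp, smul_dotProduct, dotProduct_smul, smul_eq_mul]
  ring

theorem weyl_weyl (ξ η : ι ⊕ ι → ℝ) (f : Modes ι) :
    weyl ξ (weyl η f) = Complex.exp (Complex.I * ((sympForm ξ η / 2 : ℝ) : ℂ)) •
      weyl (ξ + η) f := by
  refine Lp.ext ((coeFn_weyl ξ (coeFn_weyl η .rfl)).trans (.trans ?_ (Lp.coeFn_smul _ _).symm))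
  filter_upwards [coeFn_weyl (ξ + η) (f := f) .rfl] with x hx
  have hphase : weylPhase ξ x * weylPhase η (x - ξ ∘ Sum.inl) =
      Complex.exp (Complex.I * ((sympForm ξ η / 2 : ℝ) : ℂ)) * weylPhase (ξ + η) x := by
    simp only [weylPhase, ← exp_I_mul_ofReal_add]
    congr 3
    simp only [sympForm, Pi.add_comp, add_dotProduct, dotProduct_add, dotProduct_sub,
      dotProduct_comm (ξ ∘ Sum.inr) (η ∘ Sum.inl), dotProduct_comm (η ∘ Sum.inr) (ξ ∘ Sum.inl)]
    ring
  rw [Pi.smul_apply, hx, smul_eq_mul, ← mul_assoc, ← mul_assoc, hphase, sub_sub, Pi.add_comp]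

theorem weyl_comm (ξ η : ι ⊕ ι → ℝ) (f : Modes ι) : weyl ξ (weyl η f) =
    Complex.exp (Complex.I * ((sympForm ξ η : ℝ) : ℂ)) • weyl η (weyl ξ f) := by
  rw [weyl_weyl, weyl_weyl, smul_smul, ← exp_I_mul_ofReal_add, add_comm η, sympForm_comm η, neg_div,
    ← sub_eq_add_neg, sub_half]

theorem weyl_neg_weyl (ξ : ι ⊕ ι → ℝ) (f : Modes ι) : weyl (-ξ) (weyl ξ f) = f := by
  simp [weyl_weyl, sympForm_neg_left, sympForm_self, weyl_zero]

/-- The Weyl operator as a unitary. -/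
def weylEquiv (ξ : ι ⊕ ι → ℝ) : Modes ι ≃ₗᵢ[ℂ] Modes ι :=
  LinearIsometryEquiv.ofSurjective (isIsometricWeightedComp_weyl ξ).toLinearIsometry fun f =>
    ⟨weyl (-ξ) f, by
      have h := weyl_neg_weyl (-ξ) f
      rwa [neg_neg] at h⟩

theorem weylEquiv_apply (ξ : ι ⊕ ι → ℝ) (f : Modes ι) : weylEquiv ξ f = weyl ξ f := rfl

theorem inner_weyl_weyl (ξ η : ι ⊕ ι → ℝ) (f g : Modes ι) :
    inner ℂ (weyl ξ f) (weyl η g) =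
      Complex.exp (-(Complex.I * ((sympForm ξ η / 2 : ℝ) : ℂ))) * inner ℂ f (weyl (η - ξ) g) := by
  rw [← (weylEquiv (-ξ)).inner_map_map, weylEquiv_apply, weylEquiv_apply, weyl_neg_weyl, weyl_weyl,
    inner_smul_right, sympForm_neg_left, neg_div, Complex.ofReal_neg, mul_neg, neg_add_eq_sub]

end Weyl

section Chirp

variable {ι : Type*} [Fintype ι]

/-- The multiplier `exp (i x·C x / 2)`. -/
def chirpPhase (C : Matrix ι ι ℝ) (x : ι → ℝ) : ℂ :=
  Complex.exp (Complex.I * ((x ⬝ᵥ C *ᵥ x / 2 : ℝ) : ℂ))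

theorem isIsometricWeightedComp_chirp (C : Matrix ι ι ℝ) :
    IsIsometricWeightedComp (chirpPhase C) id volume :=
  .of_measurePreserving
    (Continuous.measurable (by unfold chirpPhase dotProduct mulVec dotProduct; fun_prop))
    (fun _ => Complex.norm_exp_I_mul_ofReal _) (MeasurePreserving.id _)

/-- The chirp `f ↦ exp (i x·C x / 2) f`. -/
def chirp (C : Matrix ι ι ℝ) : Modes ι ≃ₗᵢ[ℂ] Modes ι :=
  (isIsometricWeightedComp_chirp C).toLinearIsometryEquiv (isIsometricWeightedComp_chirp (-C))
    (fun x => by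
      simp [chirpPhase, neg_mulVec, ← Complex.exp_add, neg_div])
    fun _ => rfl

theorem coeFn_chirp (C : Matrix ι ι ℝ) {f : Modes ι} {g : (ι → ℝ) → ℂ} (hg : f =ᵐ[volume] g) :
    chirp C f =ᵐ[volume] fun x => chirpPhase C x * g x :=
  (isIsometricWeightedComp_chirp C).coeFn_toLinearIsometry hg

end Chirp

section GaussianUnitaries

variable {ι : Type*} [Fintype ι] [DecidableEq ι]

theorem IsGaussianUnitary.trans {U V : Modes ι ≃ₗᵢ[ℂ] Modes ι} (hU : IsGaussianUnitary U)
    (hV : IsGaussianUnitary V) : IsGaussianUnitary (U.trans V) := by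
  obtain ⟨S, hS, d, hd⟩ := hU
  obtain ⟨S', hS', d', hd'⟩ := hV
  refine ⟨S' * S, mul_mem hS' hS, d + Sᵀ *ᵥ d', fun ξ f => ?_⟩
  rw [LinearIsometryEquiv.trans_apply, hd, map_smul, hd', smul_smul, mulVec_mulVec,
    LinearIsometryEquiv.trans_apply, ← exp_I_mul_ofReal_add, add_dotProduct, mulVec_transpose,
    dotProduct_mulVec]

theorem isGaussianUnitary_weylEquiv (η : ι ⊕ ι → ℝ) : IsGaussianUnitary (weylEquiv η) := by
  refine ⟨1, one_mem _, -(J ι ℝ *ᵥ η), fun ξ f => ?_⟩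
  have hd : (-(J ι ℝ *ᵥ η)) ⬝ᵥ ξ = sympForm η ξ := by
    rw [neg_dotProduct, dotProduct_comm, ← sympForm_eq, sympForm_comm η]
  rw [hd, weylEquiv_apply, weylEquiv_apply, one_mulVec, weyl_comm]

/-- The unitary dilation `f ↦ |det A|^{1/2} f (A x)`. -/
def dilation (A : Matrix ι ι ℝ) (hA : A.det ≠ 0) : Modes ι ≃ₗᵢ[ℂ] Modes ι :=
  (IsIsometricWeightedComp.of_matrix hA).toLinearIsometryEquiv
    (.of_matrix (A := A⁻¹) (by simpa [det_nonsing_inv] using hA))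
    (fun _ => by
      rw [← Complex.ofReal_mul, ← Real.sqrt_mul (abs_nonneg _), ← abs_mul, det_nonsing_inv,
        Ring.mul_inverse_cancel _ hA.isUnit, abs_one, Real.sqrt_one, Complex.ofReal_one])
    (fun x => by rw [mulVec_mulVec, nonsing_inv_mul _ hA.isUnit, one_mulVec])

theorem coeFn_dilation {A : Matrix ι ι ℝ} (hA : A.det ≠ 0) {f : Modes ι} {g : (ι → ℝ) → ℂ}
    (hg : f =ᵐ[volume] g) :
    dilation A hA f =ᵐ[volume] fun x => ((√|A.det| : ℝ) : ℂ) * g (A *ᵥ x) :=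
  (IsIsometricWeightedComp.of_matrix hA).coeFn_toLinearIsometry hg

theorem dilation_weyl {A : Matrix ι ι ℝ} (hA : A.det ≠ 0) (ξ : ι ⊕ ι → ℝ) (f : Modes ι) :
    dilation A hA (weyl ξ f) = weyl (fromBlocks A⁻¹ 0 0 Aᵀ *ᵥ ξ) (dilation A hA f) := by
  obtain ⟨a, b, rfl⟩ : ∃ a b, ξ = Sum.elim a b := ⟨_, _, (Sum.elim_comp_inl_inr ξ).symm⟩
  have hS : fromBlocks A⁻¹ 0 0 Aᵀ *ᵥ Sum.elim a b = Sum.elim (A⁻¹ *ᵥ a) (Aᵀ *ᵥ b) := by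
    simp [fromBlocks_mulVec]
  have hAA (y : ι → ℝ) : A *ᵥ (A⁻¹ *ᵥ y) = y := by
    rw [mulVec_mulVec, mul_nonsing_inv _ hA.isUnit, one_mulVec]
  refine Lp.ext ((coeFn_dilation hA (coeFn_weyl _ .rfl)).trans
    (.trans (.of_forall fun x => ?_) (coeFn_weyl _ (coeFn_dilation hA .rfl)).symm))
  have hphase : weylPhase (Sum.elim (A⁻¹ *ᵥ a) (Aᵀ *ᵥ b)) x =
      weylPhase (Sum.elim a b) (A *ᵥ x) := by
    simp only [weylPhase, Sum.elim_comp_inl, Sum.elim_comp_inr, hAA,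
      mulVec_transpose, dotProduct_comm _ (b ᵥ* A), ← dotProduct_mulVec, dotProduct_comm b a]
  simp only [hS, hphase, Sum.elim_comp_inl, mulVec_sub, hAA]
  ring

theorem chirp_weyl {C : Matrix ι ι ℝ} (hC : Cᵀ = C) (ξ : ι ⊕ ι → ℝ) (f : Modes ι) :
    chirp C (weyl ξ f) = weyl (fromBlocks 1 0 C 1 *ᵥ ξ) (chirp C f) := by
  obtain ⟨a, b, rfl⟩ : ∃ a b, ξ = Sum.elim a b := ⟨_, _, (Sum.elim_comp_inl_inr ξ).symm⟩
  have hS : fromBlocks 1 0 C 1 *ᵥ Sum.elim a b = Sum.elim a (C *ᵥ a + b) := by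
    simp [fromBlocks_mulVec]
  refine Lp.ext ((coeFn_chirp C (coeFn_weyl _ .rfl)).trans
    (.trans (.of_forall fun x => ?_) (coeFn_weyl _ (coeFn_chirp C .rfl)).symm))
  have hphase : chirpPhase C x * weylPhase (Sum.elim a b) x =
      weylPhase (Sum.elim a (C *ᵥ a + b)) x * chirpPhase C (x - a) := by
    have hsymm : x ⬝ᵥ C *ᵥ a = a ⬝ᵥ C *ᵥ x := by
      rw [dotProduct_comm, dotProduct_mulVec, ← mulVec_transpose, hC]
    simp only [weylPhase, chirpPhase, Sum.elim_comp_inl, Sum.elim_comp_inr,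
      ← exp_I_mul_ofReal_add]
    congr 3
    simp only [mulVec_sub, sub_dotProduct, dotProduct_sub, add_dotProduct, dotProduct_add, hsymm,
      dotProduct_comm (C *ᵥ a) x]
    ring
  simp only [hS, Sum.elim_comp_inl, ← mul_assoc, hphase]

theorem chirp_trans_dilation_weyl {B C : Matrix ι ι ℝ} (hB : B.det ≠ 0) (hC : Cᵀ = C)
    (ξ : ι ⊕ ι → ℝ) (f : Modes ι) :
    ((chirp (-C)).trans (dilation B hB)) (weyl (lowerSymplectic B C *ᵥ ξ) f) =
      weyl ξ (((chirp (-C)).trans (dilation B hB)) f) := by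
  have hBB : Bᵀ * (B⁻¹)ᵀ = 1 := by rw [← transpose_mul, nonsing_inv_mul _ hB.isUnit, transpose_one]
  have hL : fromBlocks B⁻¹ 0 0 Bᵀ * fromBlocks 1 0 (-C) 1 * lowerSymplectic B C = 1 := by
    simp [lowerSymplectic, fromBlocks_multiply, nonsing_inv_mul _ hB.isUnit, hBB, Matrix.mul_assoc]
  rw [LinearIsometryEquiv.trans_apply, chirp_weyl (by rw [transpose_neg, hC]), dilation_weyl,
    mulVec_mulVec, mulVec_mulVec, hL, one_mulVec, LinearIsometryEquiv.trans_apply]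

theorem isGaussianUnitary_chirp_trans_dilation {B C : Matrix ι ι ℝ} (hB : B.det ≠ 0)
    (hC : Cᵀ = C) : IsGaussianUnitary ((chirp (-C)).trans (dilation B hB)) := by
  have hmem := lowerSymplectic_mem hB hC
  refine ⟨(lowerSymplectic B C)⁻¹, inv_mem_symplecticGroup hmem, 0, fun ξ f => ?_⟩
  rw [← chirp_trans_dilation_weyl hB hC, mulVec_mulVec,
    mul_nonsing_inv _ (SymplecticGroup.symplectic_det hmem), one_mulVec]
  simp

end GaussianUnitaries

section GramDerivative

theorem second_difference_le {k k' : ℝ → ℂ} {c : ℂ} (hk : ∀ t, HasDerivAt k (k' t) t)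
    (hk' : HasStrictDerivAt k' c 0) {ε : ℝ} (hε : 0 < ε) :
    ∃ r > 0, ∀ s t : ℝ, |s| < r → |t| < r →
      ‖k (t - s) - k t - k (-s) + k 0 + c * s * t‖ ≤ ε * |s| * |t| := by
  obtain ⟨r, hr, hball⟩ := Metric.eventually_nhds_iff.1 (hk'.isLittleO.def hε)
  refine ⟨r / 2, by positivity, fun s t hs ht => ?_⟩
  have hderiv : ∀ x ∈ Metric.ball (0 : ℝ) (r / 2),
      HasDerivWithinAt (fun x => k (x - s) - k x + c * s * x)
        (k' (x - s) - k' x + c * s) (Metric.ball (0 : ℝ) (r / 2)) x := by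
    intro x _
    have hshift : HasDerivAt (fun x : ℝ => k (x - s)) (k' (x - s)) x := (hk _).comp_sub_const x s
    have hlin : HasDerivAt (fun x : ℝ => c * s * (x : ℂ)) (c * s) x := by
      simpa using (Complex.ofRealCLM.hasDerivAt (x := x)).const_mul (c * s)
    exact ((hshift.sub (hk x)).add hlin).hasDerivWithinAt
  have hbound : ∀ x ∈ Metric.ball (0 : ℝ) (r / 2), ‖k' (x - s) - k' x + c * s‖ ≤ ε * |s| := by
    intro x hx
    rw [Metric.mem_ball, dist_zero_right, Real.norm_eq_abs] at hx
    have hxs : dist (x - s, x) ((0 : ℝ), (0 : ℝ)) < r := by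
      rw [Prod.dist_eq, max_lt_iff, Real.dist_eq, Real.dist_eq, sub_zero, sub_zero]
      exact ⟨(abs_sub x s).trans_lt (by linarith), by linarith⟩
    simpa [sub_eq_add_neg, add_comm, mul_comm] using hball hxs
  have hmean := (convex_ball (0 : ℝ) (r / 2)).norm_image_sub_le_of_norm_hasDerivWithin_le hderiv
    hbound (Metric.mem_ball_self (by positivity)) (y := t) (by simpa using ht)
  simp only [sub_zero, Real.norm_eq_abs, zero_sub, Complex.ofReal_zero, mul_zero, add_zero] at hmean
  refine le_of_eq_of_le (congrArg norm ?_) hmean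
  ring

theorem tendsto_second_difference {k k' : ℝ → ℂ} {c : ℂ} (hk : ∀ t, HasDerivAt k (k' t) t)
    (hk' : HasStrictDerivAt k' c 0) :
    Tendsto (fun p : ℝ × ℝ => ((p.1⁻¹ * p.2⁻¹ : ℝ) : ℂ) *
      (k (p.2 - p.1) - k p.2 - k (-p.1) + k 0)) (𝓝[≠] 0 ×ˢ 𝓝[≠] 0) (𝓝 (-c)) := by
  rw [Metric.tendsto_nhds]
  intro ε hε
  obtain ⟨r, hr, h⟩ := second_difference_le hk hk' (half_pos hε)
  have hev : ∀ᶠ t in 𝓝[≠] (0 : ℝ), |t| < r ∧ t ≠ 0 := by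
    refine .and (nhdsWithin_le_nhds ?_) self_mem_nhdsWithin
    simpa [Metric.ball, Real.dist_eq] using Metric.ball_mem_nhds (0 : ℝ) hr
  filter_upwards [hev.prod_mk hev] with ⟨s, t⟩ ⟨⟨hs, hs0⟩, ht, ht0⟩
  have hfactor : ((s⁻¹ * t⁻¹ : ℝ) : ℂ) * (k (t - s) - k t - k (-s) + k 0) - -c =
      ((s⁻¹ * t⁻¹ : ℝ) : ℂ) * (k (t - s) - k t - k (-s) + k 0 + c * s * t) := by
    have hsC : (s : ℂ) ≠ 0 := by exact_mod_cast hs0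
    have htC : (t : ℂ) ≠ 0 := by exact_mod_cast ht0
    push_cast
    field_simp
    ring
  have := abs_pos.2 hs0
  have := abs_pos.2 ht0
  rw [dist_eq_norm, hfactor, norm_mul, Complex.norm_real, Real.norm_eq_abs, abs_mul, abs_inv,
    abs_inv]
  calc |s|⁻¹ * |t|⁻¹ * ‖k (t - s) - k t - k (-s) + k 0 + c * s * t‖
      ≤ |s|⁻¹ * |t|⁻¹ * (ε / 2 * |s| * |t|) := by gcongr; exact h s t hs ht
    _ = ε / 2 := by field_simp
    _ < ε := half_lt_self hε

variable {E : Type*} [NormedAddCommGroup E] [InnerProductSpace ℂ E]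

theorem exists_tendsto_of_tendsto_inner [CompleteSpace E] {α : Type*} {l : Filter α} [l.NeBot]
    {v : α → E} {c : ℂ} (h : Tendsto (fun p : α × α => inner ℂ (v p.1) (v p.2)) (l ×ˢ l) (𝓝 c)) :
    ∃ w, Tendsto v l (𝓝 w) := by
  have hre {f : α × α → α × α} (hf : Tendsto f (l ×ˢ l) (l ×ˢ l)) :
      Tendsto (fun p => (inner ℂ (v (f p).1) (v (f p).2)).re) (l ×ˢ l) (𝓝 c.re) :=
    (Complex.continuous_re.tendsto c).comp (h.comp hf)
  have hsq : Tendsto (fun p : α × α => ‖v p.1 - v p.2‖ ^ 2) (l ×ˢ l) (𝓝 0) := by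
    convert ((hre (tendsto_fst.prodMk tendsto_fst)).sub ((hre tendsto_id).const_mul 2)).add
      (hre (tendsto_snd.prodMk tendsto_snd)) using 1
    · ext p
      rw [norm_sub_sq (𝕜 := ℂ), ← inner_self_eq_norm_sq (𝕜 := ℂ), ← inner_self_eq_norm_sq (𝕜 := ℂ)]
      rfl
    · ring_nf
  have hcauchy : Cauchy (map v l) := by
    rw [cauchy_map_iff, tendsto_uniformity_iff_dist_tendsto_zero]
    refine ⟨‹_›, ?_⟩
    simpa only [dist_eq_norm, Function.comp_def, Real.sqrt_sq (norm_nonneg _), Real.sqrt_zero]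
      using (Real.continuous_sqrt.tendsto 0).comp hsq
  exact CompleteSpace.complete hcauchy

theorem differentiableAt_of_inner_eq [CompleteSpace E] {w : ℝ → E} {k k' : ℝ → ℂ} {c : ℂ}
    (hw : ∀ s t, inner ℂ (w s) (w t) = k (t - s)) (hk : ∀ t, HasDerivAt k (k' t) t)
    (hk' : HasStrictDerivAt k' c 0) : DifferentiableAt ℝ w 0 := by
  have hgram (s t : ℝ) : inner ℂ (s⁻¹ • (w s - w 0)) (t⁻¹ • (w t - w 0)) =
      ((s⁻¹ * t⁻¹ : ℝ) : ℂ) * (k (t - s) - k t - k (-s) + k 0) := by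
    rw [← Complex.coe_smul, ← Complex.coe_smul, inner_smul_left, inner_smul_right, inner_sub_left,
      inner_sub_right, inner_sub_right, hw, hw, hw, hw, Complex.conj_ofReal, Complex.ofReal_mul,
      sub_zero, zero_sub, sub_zero]
    ring
  obtain ⟨v, hv⟩ := exists_tendsto_of_tendsto_inner (v := fun t : ℝ => t⁻¹ • (w t - w 0))
    (l := 𝓝[≠] 0) (by simpa only [hgram] using tendsto_second_difference hk hk')
  refine HasDerivAt.differentiableAt (f' := v) ?_
  rw [hasDerivAt_iff_tendsto_slope_zero]
  simpa using hv

theorem inner_eq_of_hasDerivAt {u v : ℝ → E} {u' v' : E} {k' : ℝ → ℂ} {c : ℂ}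
    (hu : HasDerivAt u u' 0) (hv : HasDerivAt v v' 0)
    (hk : ∀ t, HasDerivAt (fun s => inner ℂ (u s) (v t)) (k' t) 0) (hk' : HasDerivAt k' c 0) :
    inner ℂ u' v' = c := by
  have hk'_eq : k' = fun t => inner ℂ u' (v t) := funext fun t =>
    (hk t).unique (by simpa using hu.inner ℂ (hasDerivAt_const (0 : ℝ) (v t)))
  rw [hk'_eq] at hk'
  exact HasDerivAt.unique (by simpa using (hasDerivAt_const (0 : ℝ) u').inner ℂ hv) hk'

end GramDerivative

theorem hasDerivAt_cexp_quadratic (a b : ℂ) (t : ℝ) :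
    HasDerivAt (fun t : ℝ => Complex.exp (a * t + b * t ^ 2))
      ((a + 2 * b * t) * Complex.exp (a * t + b * t ^ 2)) t := by
  have hcoe : HasDerivAt (fun t : ℝ => (t : ℂ)) 1 t := Complex.ofRealCLM.hasDerivAt
  have hquad : HasDerivAt (fun t : ℝ => a * t + b * t ^ 2) (a + 2 * b * t) t :=
    ((hcoe.const_mul a).add ((hcoe.pow 2).const_mul b)).congr_deriv (by push_cast; ring)
  exact hquad.cexp.congr_deriv (mul_comm _ _)

theorem hasDerivAt_mul_cexp_quadratic (a b c e : ℂ) :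
    HasDerivAt (fun t : ℝ => (c + e * t) * Complex.exp (a * t + b * t ^ 2)) (e + c * a) 0 := by
  have hlin : HasDerivAt (fun t : ℝ => c + e * (t : ℂ)) e 0 := by
    simpa using ((Complex.ofRealCLM.hasDerivAt (x := (0 : ℝ))).const_mul e).const_add c
  refine (hlin.mul (hasDerivAt_cexp_quadratic a b 0)).congr_deriv ?_
  simp

section GaussianStates

variable {ι : Type*} [Fintype ι]

/-- The characteristic function `ξ ↦ ⟨φ, W(ξ) φ⟩` of `φ` is the Gaussian with first moments `d`
and (in the dual ordering of the quadratures) covariance matrix `M`. -/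
structure HasGaussianChar (φ : Modes ι) (d : ι ⊕ ι → ℝ) (M : Matrix (ι ⊕ ι) (ι ⊕ ι) ℝ) : Prop where
  isSymm : M.IsSymm
  inner_weyl : ∀ ξ, inner ℂ φ (weyl ξ φ) =
    Complex.exp (Complex.I * ((d ⬝ᵥ ξ : ℝ) : ℂ) - ((ξ ⬝ᵥ M *ᵥ ξ / 4 : ℝ) : ℂ))

/-- The derivative `i R(ξ) φ` of the Weyl orbit of `φ` in the direction `ξ`; meaningful where that
orbit is differentiable. -/
def weylDeriv (φ : Modes ι) (ξ : ι ⊕ ι → ℝ) : Modes ι :=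
  deriv (fun t : ℝ => weyl (t • ξ) φ) 0

namespace HasGaussianChar

variable {φ : Modes ι} {d : ι ⊕ ι → ℝ} {M : Matrix (ι ⊕ ι) (ι ⊕ ι) ℝ}

theorem inner_self (h : HasGaussianChar φ d M) : inner ℂ φ φ = 1 := by
  simpa [weyl_zero] using h.inner_weyl 0

theorem dotProduct_mulVec_comm (h : HasGaussianChar φ d M) (ξ η : ι ⊕ ι → ℝ) :
    ξ ⬝ᵥ M *ᵥ η = η ⬝ᵥ M *ᵥ ξ := by
  rw [dotProduct_mulVec, ← mulVec_transpose, h.isSymm.eq, dotProduct_comm]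

theorem inner_weyl_smul_weyl_smul (h : HasGaussianChar φ d M) (ξ η : ι ⊕ ι → ℝ) (s t : ℝ) :
    inner ℂ (weyl (s • ξ) φ) (weyl (t • η) φ) = Complex.exp (
      (-(Complex.I * (d ⬝ᵥ ξ : ℝ)) +
        (((ξ ⬝ᵥ M *ᵥ η / 2 : ℝ) : ℂ) - Complex.I * ((sympForm ξ η / 2 : ℝ) : ℂ)) * t) * s +
      (-(ξ ⬝ᵥ M *ᵥ ξ / 4 : ℝ) : ℂ) * s ^ 2 +
      (Complex.I * (d ⬝ᵥ η : ℝ) * t + (-(η ⬝ᵥ M *ᵥ η / 4 : ℝ) : ℂ) * t ^ 2)) := by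
  have hquad : (t • η - s • ξ) ⬝ᵥ M *ᵥ (t • η - s • ξ) =
      t ^ 2 * (η ⬝ᵥ M *ᵥ η) - 2 * s * t * (ξ ⬝ᵥ M *ᵥ η) + s ^ 2 * (ξ ⬝ᵥ M *ᵥ ξ) := by
    simp only [mulVec_sub, mulVec_smul, dotProduct_sub, sub_dotProduct, smul_dotProduct,
      dotProduct_smul, smul_eq_mul, h.dotProduct_mulVec_comm η ξ]
    ring
  rw [inner_weyl_weyl, h.inner_weyl, ← Complex.exp_add, sympForm_smul_smul, hquad,
    dotProduct_sub, dotProduct_smul, dotProduct_smul, smul_eq_mul, smul_eq_mul]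
  congr 1
  push_cast
  ring

theorem differentiableAt_weyl (h : HasGaussianChar φ d M) (ξ : ι ⊕ ι → ℝ) :
    DifferentiableAt ℝ (fun t : ℝ => weyl (t • ξ) φ) 0 := by
  set a : ℂ := Complex.I * (d ⬝ᵥ ξ : ℝ)
  set b : ℂ := -(ξ ⬝ᵥ M *ᵥ ξ / 4 : ℝ)
  have hsmooth : ContDiff ℝ 1 fun t : ℝ =>
      (a + 2 * b * t) * Complex.exp (a * t + b * t ^ 2) := by
    have hofReal : ContDiff ℝ 1 fun t : ℝ => (t : ℂ) := Complex.ofRealCLM.contDiff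
    fun_prop
  refine differentiableAt_of_inner_eq (k := fun t => Complex.exp (a * t + b * t ^ 2))
    (fun s t => ?_) (hasDerivAt_cexp_quadratic a b) (hsmooth.contDiffAt.hasStrictDerivAt'
      (hasDerivAt_mul_cexp_quadratic a b a (2 * b)) one_ne_zero)
  rw [h.inner_weyl_smul_weyl_smul, sympForm_self]
  congr 1
  simp only [a, b]
  push_cast
  ring

theorem inner_weylDeriv_weylDeriv (h : HasGaussianChar φ d M) (ξ η : ι ⊕ ι → ℝ) :
    inner ℂ (weylDeriv φ ξ) (weylDeriv φ η) =
      ((ξ ⬝ᵥ M *ᵥ η / 2 + (d ⬝ᵥ ξ) * (d ⬝ᵥ η) : ℝ) : ℂ) -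
        Complex.I * ((sympForm ξ η / 2 : ℝ) : ℂ) := by
  refine inner_eq_of_hasDerivAt (h.differentiableAt_weyl ξ).hasDerivAt
    (h.differentiableAt_weyl η).hasDerivAt (fun t => ?_) ((hasDerivAt_mul_cexp_quadratic
      (Complex.I * (d ⬝ᵥ η : ℝ)) (-(η ⬝ᵥ M *ᵥ η / 4 : ℝ)) (-(Complex.I * (d ⬝ᵥ ξ : ℝ)))
      (((ξ ⬝ᵥ M *ᵥ η / 2 : ℝ) : ℂ) - Complex.I * ((sympForm ξ η / 2 : ℝ) : ℂ))).congr_deriv ?_)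
  · simp only [h.inner_weyl_smul_weyl_smul, Complex.exp_add _ (_ + _)]
    refine ((hasDerivAt_cexp_quadratic _ _ 0).mul_const _).congr_deriv ?_
    simp
  · push_cast
    linear_combination (-((d ⬝ᵥ ξ : ℝ) : ℂ) * (d ⬝ᵥ η : ℝ)) * Complex.I_sq

theorem inner_weylDeriv (h : HasGaussianChar φ d M) (ξ : ι ⊕ ι → ℝ) :
    inner ℂ φ (weylDeriv φ ξ) = Complex.I * (d ⬝ᵥ ξ : ℝ) := by
  have hchar (t : ℝ) : inner ℂ φ (weyl (t • ξ) φ) = Complex.exp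
      (Complex.I * (d ⬝ᵥ ξ : ℝ) * t + (-(ξ ⬝ᵥ M *ᵥ ξ / 4 : ℝ) : ℂ) * t ^ 2) := by
    simpa [weyl_zero] using h.inner_weyl_smul_weyl_smul 0 ξ 0 t
  have hderiv : HasDerivAt (fun t : ℝ => inner ℂ φ (weyl (t • ξ) φ))
      (inner ℂ φ (weylDeriv φ ξ)) 0 := by
    refine ((hasDerivAt_const (0 : ℝ) φ).inner ℂ
      (h.differentiableAt_weyl ξ).hasDerivAt).congr_deriv ?_
    simp only [inner_zero_left, add_zero, weylDeriv]
  simp only [hchar] at hderiv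
  rw [hderiv.unique (hasDerivAt_cexp_quadratic _ _ 0)]
  simp

end HasGaussianChar

variable [DecidableEq ι]

/-- The unimodular factor by which a quadrature differs from the derivative of its orbit. -/
def quadCoeff {ι : Type*} : ι ⊕ ι → ℂ := Sum.elim (fun _ => -Complex.I) (fun _ => Complex.I)

theorem quad_eq (φ : Modes ι) (s : ι ⊕ ι) :
    quad φ s = quadCoeff s • weylDeriv φ (Pi.single s.swap 1) := by
  cases s <;> rfl

namespace HasGaussianChar

variable {φ : Modes ι} {d : ι ⊕ ι → ℝ} {M : Matrix (ι ⊕ ι) (ι ⊕ ι) ℝ}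

theorem finiteEnergy (h : HasGaussianChar φ d M) : FiniteEnergy φ := by
  rintro (i | i) <;> exact h.differentiableAt_weyl _

theorem norm_quad_sq (h : HasGaussianChar φ d M) (s : ι ⊕ ι) :
    ‖quad φ s‖ ^ 2 = M s.swap s.swap / 2 + d s.swap ^ 2 := by
  have hcoeff : ‖quadCoeff s‖ = 1 := by cases s <;> simp [quadCoeff]
  rw [quad_eq, norm_smul, hcoeff, one_mul, ← inner_self_eq_norm_sq (𝕜 := ℂ),
    h.inner_weylDeriv_weylDeriv]
  simp [sq, sympForm_self]

theorem energy_eq (h : HasGaussianChar φ d M) : energy φ = M.trace / 4 + (d ⬝ᵥ d) / 2 := by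
  simp only [energy, h.norm_quad_sq]
  have hswap : ∑ s : ι ⊕ ι, (M s.swap s.swap / 2 + d s.swap ^ 2) = ∑ s, (M s s / 2 + d s ^ 2) :=
    (Equiv.sumComm ι ι).sum_comp fun s => M s s / 2 + d s ^ 2
  rw [hswap, Finset.sum_add_distrib, ← Finset.sum_div, trace, dotProduct]
  simp only [diag_apply, sq]
  ring

theorem covMatrix_eq (h : HasGaussianChar φ d M) : covMatrix φ = (-J ι ℝ)ᵀ * M * (-J ι ℝ) := by
  ext s t
  simp only [covMatrix, of_apply, meanVec, quad_eq, inner_smul_left, inner_smul_right,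
    h.inner_weylDeriv, h.inner_weylDeriv_weylDeriv]
  rcases s with s | s <;> rcases t with t | t <;>
    simp [quadCoeff, J, mul_apply, Fintype.sum_sum_type, one_apply] <;> ring

theorem symplecticEigenvalues_reducedCov (h : HasGaussianChar φ d M) (B : Finset ι) :
    symplecticEigenvalues (reducedCov B φ) =
      symplecticEigenvalues (M.submatrix (blockIncl B) (blockIncl B)) := by
  have hcov : reducedCov B φ =
      (-J B ℝ)ᵀ * M.submatrix (blockIncl B) (blockIncl B) * (-J B ℝ) := by
    rw [reducedCov, h.covMatrix_eq]
    ext s t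
    rcases s with s | s <;> rcases t with t | t <;>
      simp [J, mul_apply, Fintype.sum_sum_type, one_apply]
  rw [hcov, symplecticEigenvalues_congr (SymplecticGroup.neg_mem (SymplecticGroup.J_mem ..))]

end HasGaussianChar

end GaussianStates

section FourierTransform

open FourierTransform
open scoped SchwartzMap

variable {V : Type*} [NormedAddCommGroup V] [InnerProductSpace ℝ V] [FiniteDimensional ℝ V]
  [MeasurableSpace V] [BorelSpace V]

theorem integral_fourier_smul_eq (g : 𝓢(V, ℂ)) {f : V → ℂ} (hf : Integrable f) :
    ∫ w, 𝓕 g w • f w = ∫ v, g v • 𝓕 f v := by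
  simpa using! VectorFourier.integral_fourierIntegral_smul_eq_flip (L := innerₗ V)
    Real.continuous_fourierChar continuous_inner g.integrable hf

theorem ae_eq_of_integral_schwartz_smul_eq {f₁ f₂ : V → ℂ} (hf₁ : LocallyIntegrable f₁)
    (hf₂ : LocallyIntegrable f₂) (h : ∀ g : 𝓢(V, ℂ), ∫ x, g x • f₁ x = ∫ x, g x • f₂ x) :
    f₁ =ᵐ[volume] f₂ := by
  refine ae_eq_of_integral_contDiff_smul_eq hf₁ hf₂ fun g hg hsupp => ?_
  have hsupp' : HasCompactSupport (Complex.ofRealCLM ∘ g) := hsupp.comp_left rfl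
  simpa using h (hsupp'.toSchwartzMap (Complex.ofRealCLM.contDiff.comp hg))

theorem locallyIntegrable_fourier {f : V → ℂ} (hf : Integrable f) : LocallyIntegrable (𝓕 f) :=
  (VectorFourier.fourierIntegral_continuous Real.continuous_fourierChar continuous_inner
    hf).locallyIntegrable

theorem eLpNorm_fourier {f : V → ℂ} (hf : Integrable f) (hf₂ : MemLp f 2) :
    eLpNorm (𝓕 f) 2 volume = eLpNorm f 2 volume := by
  set F : Lp ℂ 2 (volume : Measure V) := 𝓕 (hf₂.toLp f)
  have hae : 𝓕 f =ᵐ[volume] F := by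
    refine ae_eq_of_integral_schwartz_smul_eq (locallyIntegrable_fourier hf)
      ((Lp.memLp _).locallyIntegrable one_le_two) fun g => ?_
    calc ∫ v, g v • 𝓕 f v = ∫ w, 𝓕 g w • f w := (integral_fourier_smul_eq g hf).symm
      _ = ∫ w, 𝓕 g w • hf₂.toLp f w :=
        integral_congr_ae (hf₂.coeFn_toLp.mono fun w hw => by simp only [hw])
      _ = ∫ v, g v • F v := by
        rw [← Lp.toTemperedDistribution_apply, ← Lp.toTemperedDistribution_apply,
          ← Lp.fourier_toTemperedDistribution_eq, TemperedDistribution.fourier_apply]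
  rw [eLpNorm_congr_ae hae, ← Lp.enorm_def, ← enorm_norm, Lp.norm_fourier_eq, enorm_norm,
    Lp.enorm_def, eLpNorm_congr_ae hf₂.coeFn_toLp]

end FourierTransform

section PhaseFourier

open FourierTransform

variable {ι : Type*} [Fintype ι]

/-- The Fourier transform on `ℝ^ι` in the normalization `∫ exp (i b·x) g(x) dx` in which it occurs
in matrix elements of Weyl operators. -/
def phaseFourier (g : (ι → ℝ) → ℂ) (b : ι → ℝ) : ℂ :=
  ∫ x, Complex.exp (Complex.I * ((b ⬝ᵥ x : ℝ) : ℂ)) * g x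

theorem phaseFourier_eq_fourier (g : (ι → ℝ) → ℂ) (b : ι → ℝ) :
    phaseFourier g b =
      𝓕 (g ∘ WithLp.ofLp : EuclideanSpace ℝ ι → ℂ) (WithLp.toLp 2 (-(2 * Real.pi)⁻¹ • b)) := by
  rw [phaseFourier, Real.fourier_eq',
    ← (PiLp.volume_preserving_ofLp ι).integral_comp
      (MeasurableEquiv.toLp 2 _).symm.measurableEmbedding]
  refine integral_congr_ae (.of_forall fun v => ?_)
  have hinner : -2 * Real.pi * inner ℝ v (WithLp.toLp 2 (-(2 * Real.pi)⁻¹ • b)) =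
      b ⬝ᵥ WithLp.ofLp v := by
    simp only [EuclideanSpace.inner_eq_star_dotProduct, star_trivial, smul_dotProduct, smul_eq_mul]
    field_simp
  simp only [hinner, Function.comp_apply, smul_eq_mul, mul_comm Complex.I]

theorem integrable_comp_ofLp {g : (ι → ℝ) → ℂ} (hg : Integrable g) :
    Integrable (g ∘ WithLp.ofLp : EuclideanSpace ℝ ι → ℂ) :=
  (PiLp.volume_preserving_ofLp ι).integrable_comp_of_integrable hg

theorem lintegral_comp_smul {E : Type*} [NormedAddCommGroup E] [NormedSpace ℝ E]
    [FiniteDimensional ℝ E] [MeasurableSpace E] [BorelSpace E] (μ : Measure E) [μ.IsAddHaarMeasure]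
    {r : ℝ} (hr : r ≠ 0) (f : E → ENNReal) :
    ∫⁻ x, f (r • x) ∂μ = ENNReal.ofReal |(r ^ Module.finrank ℝ E)⁻¹| * ∫⁻ x, f x ∂μ := by
  have hmap := (MeasurableEquiv.smul₀ r hr : E ≃ᵐ E).measurableEmbedding.lintegral_map (μ := μ) f
  rw [MeasurableEquiv.coe_smul₀] at hmap
  rw [← hmap, Measure.map_addHaar_smul μ hr, lintegral_smul_measure, smul_eq_mul]

theorem lintegral_enorm_sq {α : Type*} [MeasurableSpace α] (μ : Measure α) (f : α → ℂ) :
    ∫⁻ x, ‖f x‖ₑ ^ 2 ∂μ = eLpNorm f 2 μ ^ 2 := by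
  simpa using (eLpNorm_nnreal_pow_eq_lintegral (f := f) (μ := μ) (two_ne_zero (α := NNReal))).symm

theorem lintegral_enorm_sq_phaseFourier {g : (ι → ℝ) → ℂ} (hg : Integrable g) (hg₂ : MemLp g 2) :
    ∫⁻ b, ‖phaseFourier g b‖ₑ ^ 2 =
      ENNReal.ofReal ((2 * Real.pi) ^ Fintype.card ι) * ∫⁻ x, ‖g x‖ₑ ^ 2 := by
  set G : EuclideanSpace ℝ ι → ℂ := g ∘ WithLp.ofLp
  have hscale : ∫⁻ b, ‖𝓕 G (WithLp.toLp 2 (-(2 * Real.pi)⁻¹ • b))‖ₑ ^ 2 =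
      ENNReal.ofReal ((2 * Real.pi) ^ Fintype.card ι) * ∫⁻ b, ‖𝓕 G (WithLp.toLp 2 b)‖ₑ ^ 2 := by
    rw [lintegral_comp_smul volume (neg_ne_zero.2 (inv_ne_zero (by positivity)))
      fun b => ‖𝓕 G (WithLp.toLp 2 b)‖ₑ ^ 2, Module.finrank_fintype_fun_eq_card, abs_inv, abs_pow,
      abs_neg, abs_inv, inv_pow, inv_inv, abs_of_pos (by positivity)]
  simp only [phaseFourier_eq_fourier]
  rw [hscale, (PiLp.volume_preserving_toLp ι).lintegral_comp_emb
      (MeasurableEquiv.toLp 2 _).measurableEmbedding fun w => ‖𝓕 G w‖ₑ ^ 2,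
    lintegral_enorm_sq, eLpNorm_fourier (integrable_comp_ofLp hg)
      (hg₂.comp_measurePreserving (PiLp.volume_preserving_ofLp ι)),
    eLpNorm_comp_measurePreserving hg₂.1 (PiLp.volume_preserving_ofLp ι), lintegral_enorm_sq]

end PhaseFourier

section Moyal

variable {ι : Type*} [Fintype ι]

theorem integrable_conj_mul_shift (φ ψ : Modes ι) (a : ι → ℝ) :
    Integrable fun x => (starRingEnd ℂ) (φ x) * ψ (x - a) := by
  have hφ : MemLp (fun x => (starRingEnd ℂ) (φ x)) 2 volume := (Lp.memLp φ).star
  exact hφ.integrable_mul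
    ((Lp.memLp ψ).comp_measurePreserving (measurePreserving_sub_right volume a))

theorem measurable_conj_mul_shift (φ ψ : Modes ι) :
    Measurable fun p : (ι → ℝ) × (ι → ℝ) => (starRingEnd ℂ) (φ p.2) * ψ (p.2 - p.1) := by
  have hφ := (Lp.stronglyMeasurable φ).measurable
  have hψ := (Lp.stronglyMeasurable ψ).measurable
  exact (Complex.continuous_conj.measurable.comp (hφ.comp measurable_snd)).mul (by fun_prop)

theorem inner_weyl_eq_phaseFourier (φ ψ : Modes ι) (ξ : ι ⊕ ι → ℝ) :
    inner ℂ φ (weyl ξ ψ) =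
      Complex.exp (Complex.I * ((-((ξ ∘ Sum.inl) ⬝ᵥ (ξ ∘ Sum.inr) / 2) : ℝ) : ℂ)) *
      phaseFourier (fun x => (starRingEnd ℂ) (φ x) * ψ (x - ξ ∘ Sum.inl)) (ξ ∘ Sum.inr) := by
  rw [L2.inner_def, phaseFourier, ← integral_const_mul]
  refine integral_congr_ae ((coeFn_weyl ξ (f := ψ) .rfl).mono fun x hx => ?_)
  simp only [hx, RCLike.inner_apply, weylPhase, sub_eq_add_neg, exp_I_mul_ofReal_add]
  ring

theorem lintegral_enorm_sq_eq (φ : Modes ι) : ∫⁻ x, ‖φ x‖ₑ ^ 2 = ‖φ‖ₑ ^ 2 := by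
  rw [lintegral_enorm_sq, Lp.enorm_def]

theorem lintegral_lintegral_enorm_sq_conj_mul_shift (φ ψ : Modes ι) :
    ∫⁻ a, ∫⁻ x, ‖(starRingEnd ℂ) (φ x) * ψ (x - a)‖ₑ ^ 2 = ‖φ‖ₑ ^ 2 * ‖ψ‖ₑ ^ 2 := by
  have := (Lp.stronglyMeasurable φ).measurable
  have := (Lp.stronglyMeasurable ψ).measurable
  rw [lintegral_lintegral_swap ((measurable_conj_mul_shift φ ψ).enorm.pow_const 2).aemeasurable,
    ← lintegral_enorm_sq_eq φ, ← lintegral_mul_const _ (by fun_prop)]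
  refine lintegral_congr fun x => ?_
  simp only [enorm_mul, mul_pow, RCLike.enorm_conj]
  rw [lintegral_const_mul _ (by fun_prop), lintegral_sub_left_eq_self (fun a => ‖ψ a‖ₑ ^ 2) x,
    lintegral_enorm_sq_eq]

theorem lintegral_phaseSpace {f : (ι ⊕ ι → ℝ) → ENNReal} (hf : Measurable f) :
    ∫⁻ ξ, f ξ = ∫⁻ a, ∫⁻ b, f (Sum.elim a b) := by
  have he := (volume_measurePreserving_sumPiEquivProdPi fun _ : ι ⊕ ι => ℝ).symm
  rw [← he.lintegral_comp_emb (MeasurableEquiv.measurableEmbedding _)]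
  exact lintegral_prod _ (hf.comp (MeasurableEquiv.measurable _)).aemeasurable

theorem lintegral_enorm_sq_inner_weyl (φ ψ : Modes ι) :
    ∫⁻ ξ, ‖inner ℂ φ (weyl ξ ψ)‖ₑ ^ 2 =
      ENNReal.ofReal ((2 * Real.pi) ^ Fintype.card ι) * (‖φ‖ₑ ^ 2 * ‖ψ‖ₑ ^ 2) := by
  set F : (ι → ℝ) → (ι → ℝ) → ℂ := fun a x => (starRingEnd ℂ) (φ x) * ψ (x - a)
  have hF : Measurable fun p : (ι → ℝ) × (ι → ℝ) => F p.1 p.2 := measurable_conj_mul_shift φ ψ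
  have hmeas : Measurable fun ξ : ι ⊕ ι → ℝ =>
      ‖phaseFourier (F (ξ ∘ Sum.inl)) (ξ ∘ Sum.inr)‖ₑ ^ 2 := by
    refine ((StronglyMeasurable.integral_prod_right (f := fun (ξ : ι ⊕ ι → ℝ) x =>
      Complex.exp (Complex.I * (((ξ ∘ Sum.inr) ⬝ᵥ x : ℝ) : ℂ)) * F (ξ ∘ Sum.inl) x)
      (Measurable.stronglyMeasurable ?_)).measurable.enorm.pow_const 2)
    simp only [Function.uncurry_def, dotProduct, Function.comp_def]
    fun_prop
  have hfin : ∀ᵐ a, ∫⁻ x, ‖F a x‖ₑ ^ 2 < ⊤ := by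
    refine ae_lt_top (hF.enorm.pow_const 2).lintegral_prod_right' ?_
    rw [lintegral_lintegral_enorm_sq_conj_mul_shift]
    exact ENNReal.mul_ne_top (by simp) (by simp)
  have hslice : ∀ᵐ a, ∫⁻ b, ‖phaseFourier (F a) b‖ₑ ^ 2 =
      ENNReal.ofReal ((2 * Real.pi) ^ Fintype.card ι) * ∫⁻ x, ‖F a x‖ₑ ^ 2 := by
    filter_upwards [hfin] with a ha
    refine lintegral_enorm_sq_phaseFourier (integrable_conj_mul_shift φ ψ a)
      ⟨(integrable_conj_mul_shift φ ψ a).1, ?_⟩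
    rw [lintegral_enorm_sq] at ha
    exact (ENNReal.pow_lt_top_iff.1 ha).resolve_right two_ne_zero
  simp only [inner_weyl_eq_phaseFourier, enorm_mul, Complex.enorm_exp_I_mul_ofReal, one_mul]
  rw [lintegral_phaseSpace hmeas]
  simp only [Sum.elim_comp_inl, Sum.elim_comp_inr]
  rw [lintegral_congr_ae hslice, lintegral_const_mul' _ _ ENNReal.ofReal_ne_top,
    lintegral_lintegral_enorm_sq_conj_mul_shift]

end Moyal

section GaussianIntegral

variable {n : Type*} [Fintype n]

theorem lintegral_exp_neg_dotProduct_self :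
    ∫⁻ x : n → ℝ, ENNReal.ofReal (Real.exp (-(x ⬝ᵥ x / 2))) =
      ENNReal.ofReal (√(2 * Real.pi) ^ Fintype.card n) := by
  have hprod (x : n → ℝ) : Real.exp (-(x ⬝ᵥ x / 2)) = ∏ i, Real.exp (-(1 / 2) * x i ^ 2) := by
    rw [← Real.exp_sum, ← Finset.mul_sum, dotProduct]
    simp only [sq]
    ring_nf
  have hint : Integrable fun x : n → ℝ => ∏ i, Real.exp (-(1 / 2) * x i ^ 2) :=
    .fintype_prod fun _ => integrable_exp_neg_mul_sq one_half_pos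
  simp only [hprod]
  rw [← ofReal_integral_eq_lintegral_ofReal hint (.of_forall fun x => by positivity),
    integral_fintype_prod_volume_eq_pow fun t : ℝ => Real.exp (-(1 / 2) * t ^ 2), integral_gaussian,
    div_div_eq_mul_div, div_one, mul_comm Real.pi]

variable [DecidableEq n]

theorem lintegral_comp_mulVec {A : Matrix n n ℝ} (hA : A.det ≠ 0) {f : (n → ℝ) → ENNReal}
    (hf : Measurable f) : ∫⁻ x, f (A *ᵥ x) = ENNReal.ofReal |A.det⁻¹| * ∫⁻ x, f x := by
  have hmeas : Measurable (A *ᵥ ·) :=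
    (LinearMap.continuous_of_finiteDimensional (toLin' A)).measurable
  have hmap : Measure.map (A *ᵥ ·) volume =
      ENNReal.ofReal |A.det⁻¹| • (volume : Measure (n → ℝ)) :=
    Real.map_matrix_volume_pi_eq_smul_volume_pi hA
  rw [← lintegral_map hf hmeas, hmap, lintegral_smul_measure, smul_eq_mul]

theorem lintegral_exp_neg_dotProduct_mulVec {M : Matrix n n ℝ} (hM : M.PosDef) :
    ∫⁻ x : n → ℝ, ENNReal.ofReal (Real.exp (-(x ⬝ᵥ M *ᵥ x / 2))) =
      ENNReal.ofReal (√(2 * Real.pi) ^ Fintype.card n / √M.det) := by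
  obtain ⟨R, hR, rfl⟩ := exists_posDef_sqrt hM
  have hquad (x : n → ℝ) : x ⬝ᵥ (R * R) *ᵥ x = (R *ᵥ x) ⬝ᵥ (R *ᵥ x) := by
    simpa [transpose_eq_of_posDef hR] using (mulVec_dotProduct_mulVec_mulVec R 1 x x).symm
  have hmeas : Measurable fun x : n → ℝ => ENNReal.ofReal (Real.exp (-(x ⬝ᵥ x / 2))) := by
    unfold dotProduct
    fun_prop
  simp only [hquad]
  rw [lintegral_comp_mulVec hR.det_pos.ne' hmeas, lintegral_exp_neg_dotProduct_self, det_mul,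
    Real.sqrt_mul_self hR.det_pos.le, abs_inv, abs_of_pos hR.det_pos,
    ← ENNReal.ofReal_mul (inv_nonneg.2 hR.det_pos.le), inv_mul_eq_div]

end GaussianIntegral

section Purity

variable {ι : Type*} [Fintype ι]

theorem HasGaussianChar.enorm_inner_weyl_sq {φ : Modes ι} {d : ι ⊕ ι → ℝ}
    {M : Matrix (ι ⊕ ι) (ι ⊕ ι) ℝ} (h : HasGaussianChar φ d M) (ξ : ι ⊕ ι → ℝ) :
    ‖inner ℂ φ (weyl ξ φ)‖ₑ ^ 2 = ENNReal.ofReal (Real.exp (-(ξ ⬝ᵥ M *ᵥ ξ / 2))) := by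
  rw [h.inner_weyl, ← ofReal_norm, Complex.norm_exp, ← ENNReal.ofReal_pow (Real.exp_nonneg _),
    ← Real.exp_nat_mul]
  congr 2
  simp only [Nat.cast_ofNat, Complex.ofReal_div, Complex.ofReal_ofNat, Complex.sub_re,
    Complex.mul_re, Complex.I_re, Complex.ofReal_re, zero_mul, Complex.I_im, Complex.ofReal_im,
    mul_zero, sub_self, Complex.div_ofNat_re, zero_sub, mul_neg, neg_inj]
  ring

variable [DecidableEq ι]

theorem posDef_of_uncertainty {M : Matrix (ι ⊕ ι) (ι ⊕ ι) ℝ} (hM : M.IsSymm)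
    (hunc : ∀ ξ η, 2 * (ξ ⬝ᵥ J ι ℝ *ᵥ η) ≤ ξ ⬝ᵥ M *ᵥ ξ + η ⬝ᵥ M *ᵥ η) : M.PosDef := by
  refine PosDef.of_dotProduct_mulVec_pos
    (by rwa [IsHermitian, conjTranspose_eq_transpose_of_trivial]) fun ξ hξ => ?_
  have hnonneg : 0 ≤ ξ ⬝ᵥ M *ᵥ ξ := by simpa using hunc ξ 0
  refine hnonneg.lt_of_ne fun hzero => hξ ?_
  have hle (η : ι ⊕ ι → ℝ) (t : ℝ) : 2 * t * (ξ ⬝ᵥ J ι ℝ *ᵥ η) ≤ η ⬝ᵥ M *ᵥ η := by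
    have h := hunc (t • ξ) η
    simpa [mulVec_smul, ← hzero, mul_assoc] using h
  have horth (η : ι ⊕ ι → ℝ) : ξ ⬝ᵥ J ι ℝ *ᵥ η = 0 := by
    by_contra hne
    have h := hle η ((η ⬝ᵥ M *ᵥ η + 1) / (2 * (ξ ⬝ᵥ J ι ℝ *ᵥ η)))
    field_simp at h
    linarith
  have h := horth (-(J ι ℝ *ᵥ ξ))
  rwa [mulVec_neg, mulVec_mulVec, J_squared, neg_mulVec, neg_neg, one_mulVec,
    dotProduct_self_eq_zero] at h

namespace HasGaussianChar

variable {φ : Modes ι} {d : ι ⊕ ι → ℝ} {M : Matrix (ι ⊕ ι) (ι ⊕ ι) ℝ}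

theorem uncertainty (h : HasGaussianChar φ d M) (ξ η : ι ⊕ ι → ℝ) :
    2 * (ξ ⬝ᵥ J ι ℝ *ᵥ η) ≤ ξ ⬝ᵥ M *ᵥ ξ + η ⬝ᵥ M *ᵥ η := by
  set u : (ι ⊕ ι → ℝ) → Modes ι := fun ζ => weylDeriv φ ζ - (Complex.I * (d ⬝ᵥ ζ : ℝ)) • φ
  have hinner (ζ θ : ι ⊕ ι → ℝ) : inner ℂ (u ζ) (u θ) =
      ((ζ ⬝ᵥ M *ᵥ θ / 2 : ℝ) : ℂ) - Complex.I * ((sympForm ζ θ / 2 : ℝ) : ℂ) := by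
    have hflip : inner ℂ (weylDeriv φ ζ) φ = -(Complex.I * (d ⬝ᵥ ζ : ℝ)) := by
      rw [← inner_conj_symm, h.inner_weylDeriv]
      simp
    simp only [u, inner_sub_left, inner_sub_right, inner_smul_left, inner_smul_right, hflip,
      h.inner_self, h.inner_weylDeriv, h.inner_weylDeriv_weylDeriv, map_mul, Complex.conj_I,
      Complex.conj_ofReal]
    push_cast
    linear_combination (((d ⬝ᵥ ζ : ℝ) : ℂ) * (d ⬝ᵥ θ : ℝ)) * Complex.I_sq
  have hnorm (ζ : ι ⊕ ι → ℝ) : ‖u ζ‖ ^ 2 = ζ ⬝ᵥ M *ᵥ ζ / 2 := by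
    rw [← inner_self_eq_norm_sq (𝕜 := ℂ), hinner, sympForm_self]
    simp
  have hpos : 0 ≤ ‖u ξ + (-Complex.I) • u η‖ ^ 2 := sq_nonneg _
  rw [norm_add_sq (𝕜 := ℂ), norm_smul, inner_smul_right, hinner, norm_neg, Complex.norm_I, one_mul,
    hnorm, hnorm, sympForm_eq] at hpos
  simp only [Complex.ofReal_div, Complex.ofReal_ofNat, neg_mul, RCLike.re_to_complex,
    Complex.neg_re, Complex.mul_re, Complex.I_re, Complex.sub_re, Complex.div_ofNat_re,
    Complex.ofReal_re, zero_mul, Complex.I_im, Complex.div_ofNat_im, Complex.ofReal_im, zero_div,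
    mul_zero, sub_self, sub_zero, Complex.sub_im, Complex.mul_im, one_mul, zero_add, zero_sub,
    mul_neg, sub_neg_eq_add] at hpos
  linarith

theorem det_eq_one (h : HasGaussianChar φ d M) : M.det = 1 := by
  have hM := posDef_of_uncertainty h.isSymm h.uncertainty
  have hφ : ‖φ‖ₑ = 1 := by
    have hsq : ‖φ‖ ^ 2 = 1 := by
      rw [← inner_self_eq_norm_sq (𝕜 := ℂ), h.inner_self, RCLike.one_re]
    rw [← ofReal_norm, (pow_eq_one_iff_of_nonneg (norm_nonneg φ) two_ne_zero).1 hsq,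
      ENNReal.ofReal_one]
  have hmoyal := lintegral_enorm_sq_inner_weyl φ φ
  simp only [h.enorm_inner_weyl_sq] at hmoyal
  rw [lintegral_exp_neg_dotProduct_mulVec hM, hφ, one_pow, mul_one, mul_one,
    ENNReal.ofReal_eq_ofReal_iff (by positivity) (by positivity), Fintype.card_sum, ← two_mul,
    pow_mul, Real.sq_sqrt Real.two_pi_pos.le, div_eq_iff (Real.sqrt_pos.2 hM.det_pos).ne',
    left_eq_mul₀ (by positivity)] at hmoyal
  exact Real.sqrt_eq_one.1 hmoyal

theorem isPureCovariance (h : HasGaussianChar φ d M) : IsPureCovariance M :=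
  isPureCovariance_of_uncertainty (posDef_of_uncertainty h.isSymm h.uncertainty) h.uncertainty
    h.det_eq_one

end HasGaussianChar

end Purity

section Intertwining

variable {ι : Type*} [Fintype ι]

/-- `U W(L ζ) U† = exp (i e·ζ) W(ζ)` for some `e`. This is the defining relation of a Gaussian
unitary solved for `W(ζ)`, the form in which characteristic functions are transported. -/
def IntertwinesWeyl (U : Modes ι ≃ₗᵢ[ℂ] Modes ι) (L : Matrix (ι ⊕ ι) (ι ⊕ ι) ℝ) : Prop :=
  ∃ e : ι ⊕ ι → ℝ, ∀ ζ f,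
    U (weyl (L *ᵥ ζ) f) = Complex.exp (Complex.I * ((e ⬝ᵥ ζ : ℝ) : ℂ)) • weyl ζ (U f)

theorem HasGaussianChar.map {φ : Modes ι} {d : ι ⊕ ι → ℝ} {M : Matrix (ι ⊕ ι) (ι ⊕ ι) ℝ}
    (h : HasGaussianChar φ d M) {U : Modes ι ≃ₗᵢ[ℂ] Modes ι} {L : Matrix (ι ⊕ ι) (ι ⊕ ι) ℝ}
    (hU : IntertwinesWeyl U L) : ∃ d', HasGaussianChar (U φ) d' (Lᵀ * M * L) := by
  obtain ⟨e, he⟩ := hU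
  refine ⟨Lᵀ *ᵥ d - e, ?_, fun ζ => ?_⟩
  · rw [IsSymm, transpose_mul, transpose_mul, transpose_transpose, h.isSymm.eq, Matrix.mul_assoc]
  have hinner : inner ℂ φ (weyl (L *ᵥ ζ) φ) =
      Complex.exp (Complex.I * ((e ⬝ᵥ ζ : ℝ) : ℂ)) * inner ℂ (U φ) (weyl ζ (U φ)) := by
    rw [← U.inner_map_map, he, inner_smul_right]
  have hmean : (Lᵀ *ᵥ d - e) ⬝ᵥ ζ = d ⬝ᵥ L *ᵥ ζ - e ⬝ᵥ ζ := by
    rw [sub_dotProduct, mulVec_transpose, dotProduct_mulVec]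
  refine mul_left_cancel₀ (Complex.exp_ne_zero (Complex.I * ((e ⬝ᵥ ζ : ℝ) : ℂ))) ?_
  rw [← hinner, h.inner_weyl, ← Complex.exp_add, hmean, mulVec_dotProduct_mulVec_mulVec]
  push_cast
  ring_nf

variable [DecidableEq ι]

theorem IsGaussianUnitary.exists_intertwinesWeyl {U : Modes ι ≃ₗᵢ[ℂ] Modes ι}
    (hU : IsGaussianUnitary U) : ∃ L ∈ symplecticGroup ι ℝ, IntertwinesWeyl U L := by
  obtain ⟨S, hS, d, h⟩ := hU
  refine ⟨S⁻¹, inv_mem_symplecticGroup hS, (S⁻¹)ᵀ *ᵥ d, fun ζ f => ?_⟩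
  rw [h, mulVec_mulVec, mul_nonsing_inv _ (SymplecticGroup.symplectic_det hS), one_mulVec,
    mulVec_transpose, dotProduct_mulVec]

theorem intertwinesWeyl_chirp_trans_dilation {B C : Matrix ι ι ℝ} (hB : B.det ≠ 0) (hC : Cᵀ = C) :
    IntertwinesWeyl ((chirp (-C)).trans (dilation B hB)) (lowerSymplectic B C) :=
  ⟨0, fun ζ f => by
    rw [chirp_trans_dilation_weyl hB hC, zero_dotProduct, Complex.ofReal_zero, mul_zero,
      Complex.exp_zero, one_smul]⟩

namespace HasGaussianChar

variable {φ : Modes ι} {d : ι ⊕ ι → ℝ} {M : Matrix (ι ⊕ ι) (ι ⊕ ι) ℝ}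

theorem center (h : HasGaussianChar φ d M) :
    HasGaussianChar (weylEquiv (J ι ℝ *ᵥ d) φ) 0 M := by
  refine ⟨h.isSymm, fun ζ => ?_⟩
  have hform : sympForm ζ (J ι ℝ *ᵥ d) = -(d ⬝ᵥ ζ) := by
    rw [sympForm_eq, mulVec_mulVec, J_squared, neg_mulVec, one_mulVec, dotProduct_neg,
      dotProduct_comm]
  rw [weylEquiv_apply, weyl_comm, inner_smul_right, ← weylEquiv_apply, ← weylEquiv_apply,
    LinearIsometryEquiv.inner_map_map, h.inner_weyl, hform, ← Complex.exp_add, zero_dotProduct]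
  push_cast
  ring_nf

theorem energy_center (h : HasGaussianChar φ d M) :
    energy (weylEquiv (J ι ℝ *ᵥ d) φ) = M.trace / 4 := by
  rw [h.center.energy_eq, zero_dotProduct, zero_div, add_zero]

theorem trace_le_energy (h : HasGaussianChar φ d M) : M.trace / 4 ≤ energy φ := by
  have hd : 0 ≤ d ⬝ᵥ d := Finset.sum_nonneg fun s _ => mul_self_nonneg (d s)
  rw [h.energy_eq]
  exact le_add_of_nonneg_right (div_nonneg hd zero_le_two)

end HasGaussianChar

theorem two_mul_sum_symplecticEigenvalues_le_trace_congr {L M : Matrix (ι ⊕ ι) (ι ⊕ ι) ℝ}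
    (hL : L ∈ symplecticGroup ι ℝ) (hM : M.PosDef) :
    2 * (symplecticEigenvalues M).sum ≤ (Lᵀ * M * L).trace := by
  have hu : IsUnit L := (isUnit_iff_isUnit_det _).2 (SymplecticGroup.symplectic_det hL)
  have hpos : (Lᵀ * M * L).PosDef := by
    rw [← conjTranspose_eq_transpose_of_trivial]
    exact hM.conjTranspose_mul_mul_same (mulVec_injective_of_isUnit hu)
  rw [← symplecticEigenvalues_congr hL]
  exact two_mul_sum_symplecticEigenvalues_le_trace hpos

theorem HasGaussianChar.isLeast_globalEnergies {φ : Modes ι} {d : ι ⊕ ι → ℝ}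
    {M : Matrix (ι ⊕ ι) (ι ⊕ ι) ℝ} (h : HasGaussianChar φ d M) :
    IsLeast (globalEnergies φ) ((symplecticEigenvalues M).sum / 2) := by
  have hM := h.isPureCovariance.posDef
  constructor
  · obtain ⟨B, C, hB, hC, htrace⟩ := exists_trace_lowerSymplectic_congr hM
    obtain ⟨d', h'⟩ := h.map (intertwinesWeyl_chirp_trans_dilation hB hC)
    refine ⟨((chirp (-C)).trans (dilation B hB)).trans (weylEquiv (J ι ℝ *ᵥ d')),
      (isGaussianUnitary_chirp_trans_dilation hB hC).trans (isGaussianUnitary_weylEquiv _),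
      h'.center.finiteEnergy, ?_⟩
    rw [LinearIsometryEquiv.trans_apply, h'.energy_center, htrace]
    ring
  · rintro _ ⟨U, hU, -, rfl⟩
    obtain ⟨L, hL, hUL⟩ := hU.exists_intertwinesWeyl
    obtain ⟨d', h'⟩ := h.map hUL
    linarith [h'.trace_le_energy, two_mul_sum_symplecticEigenvalues_le_trace_congr hL hM]

end Intertwining

section BlockMatrix

variable {κ m : Type*} {n : κ → Type*} {R : Type*}

/-- The block diagonal matrix with blocks `L j`, the index set `m` being identified with the
disjoint union of the `n j` by `e`. -/
def blockMatrix [Zero R] [DecidableEq κ] (e : (Σ j, n j) ≃ m) (L : ∀ j, Matrix (n j) (n j) R) :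
    Matrix m m R :=
  reindex e e (blockDiagonal' L)

theorem blockMatrix_transpose [Zero R] [DecidableEq κ] (e : (Σ j, n j) ≃ m)
    (L : ∀ j, Matrix (n j) (n j) R) : (blockMatrix e L)ᵀ = blockMatrix e fun j => (L j)ᵀ := by
  rw [blockMatrix, transpose_reindex, blockDiagonal'_transpose, blockMatrix]

variable [Fintype κ] [∀ j, Fintype (n j)] [Fintype m]

theorem sum_eq_sum_blocks [AddCommMonoid R] (e : (Σ j, n j) ≃ m) (f : m → R) :
    ∑ s, f s = ∑ j, ∑ a, f (e ⟨j, a⟩) := by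
  rw [← e.sum_comp, Fintype.sum_sigma]

theorem trace_eq_sum_trace_blocks [AddCommMonoid R] (e : (Σ j, n j) ≃ m) (M : Matrix m m R) :
    M.trace = ∑ j, (M.submatrix (fun a => e ⟨j, a⟩) (fun a => e ⟨j, a⟩)).trace :=
  sum_eq_sum_blocks e fun s => M s s

variable [CommRing R] [DecidableEq κ]

theorem blockMatrix_mulVec (e : (Σ j, n j) ≃ m) (L : ∀ j, Matrix (n j) (n j) R) (x : m → R)
    (j : κ) : (fun a => (blockMatrix e L *ᵥ x) (e ⟨j, a⟩)) = L j *ᵥ fun a => x (e ⟨j, a⟩) := by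
  ext a
  simp only [mulVec, dotProduct, sum_eq_sum_blocks e, blockMatrix, reindex_apply, submatrix_apply,
    Equiv.symm_apply_apply]
  rw [Fintype.sum_eq_single j fun l hl => Finset.sum_eq_zero fun b _ => by
    rw [blockDiagonal'_apply_ne _ _ _ hl.symm, zero_mul]]
  simp only [blockDiagonal'_apply_eq]

theorem blockMatrix_mul_submatrix (e : (Σ j, n j) ≃ m) (L : ∀ j, Matrix (n j) (n j) R)
    {α β : Type*} (X : Matrix m α R) (g : β → α) (j : κ) :
    (blockMatrix e L * X).submatrix (fun a => e ⟨j, a⟩) g =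
      L j * X.submatrix (fun a => e ⟨j, a⟩) g := by
  ext a b
  exact congrFun (blockMatrix_mulVec e L (fun s => X s (g b)) j) a

theorem blockMatrix_congr_submatrix (e : (Σ j, n j) ≃ m) (L : ∀ j, Matrix (n j) (n j) R)
    (M : Matrix m m R) (j : κ) :
    ((blockMatrix e L)ᵀ * M * blockMatrix e L).submatrix (fun a => e ⟨j, a⟩) (fun a => e ⟨j, a⟩) =
      (L j)ᵀ * M.submatrix (fun a => e ⟨j, a⟩) (fun a => e ⟨j, a⟩) * L j := by
  have hright : (M * blockMatrix e L).submatrix (fun a => e ⟨j, a⟩) (fun a => e ⟨j, a⟩) =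
      M.submatrix (fun a => e ⟨j, a⟩) (fun a => e ⟨j, a⟩) * L j := by
    rw [← transpose_transpose (M * _), transpose_mul, blockMatrix_transpose, ← transpose_submatrix,
      blockMatrix_mul_submatrix, transpose_mul, transpose_transpose, ← transpose_submatrix,
      transpose_transpose]
  rw [Matrix.mul_assoc, blockMatrix_transpose, blockMatrix_mul_submatrix, hright, Matrix.mul_assoc]

variable [∀ j, DecidableEq (n j)]

theorem det_blockDiagonal' (L : ∀ j, Matrix (n j) (n j) R) :
    (blockDiagonal' L).det = ∏ j, (L j).det := by
  let _ : LinearOrder κ := LinearOrder.lift' _ (Fintype.equivFin κ).injective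
  rw [(blockTriangular_blockDiagonal' L).det_fintype]
  refine Finset.prod_congr rfl fun j _ => ?_
  rw [← det_submatrix_equiv_self (Equiv.sigmaSubtype j |>.symm)]
  congr 1
  ext a b
  exact blockDiagonal'_apply_eq L j a b

theorem det_blockMatrix [DecidableEq m] (e : (Σ j, n j) ≃ m) (L : ∀ j, Matrix (n j) (n j) R) :
    (blockMatrix e L).det = ∏ j, (L j).det := by
  rw [blockMatrix, det_reindex_self, det_blockDiagonal']

theorem det_blockMatrix_ne_zero [DecidableEq m] [IsDomain R] (e : (Σ j, n j) ≃ m)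
    {L : ∀ j, Matrix (n j) (n j) R} (hL : ∀ j, (L j).det ≠ 0) : (blockMatrix e L).det ≠ 0 := by
  rw [det_blockMatrix]
  exact Finset.prod_ne_zero_iff.2 fun j _ => hL j

end BlockMatrix

section Partition

variable {ι κ : Type*} {A : κ → Finset ι}

/-- The sets `A j` partition the modes; empty parts are allowed. -/
structure IsPartition (A : κ → Finset ι) : Prop where
  disjoint : Pairwise fun i j => Disjoint (A i) (A j)
  cover : ∀ m, ∃ j, m ∈ A j

theorem IsPartition.bijective (hA : IsPartition A) :
    Function.Bijective fun p : Σ j, A j => (p.2 : ι) := by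
  refine ⟨?_, fun m => (hA.cover m).elim fun j hj => ⟨⟨j, m, hj⟩, rfl⟩⟩
  rintro ⟨j, a, ha⟩ ⟨l, b, hb⟩ rfl
  obtain rfl : j = l :=
    by_contra fun hjl => Finset.disjoint_left.1 (hA.disjoint hjl) ha hb
  rfl

/-- The identification of the disjoint union of the parts with the set of modes. -/
def IsPartition.equiv (hA : IsPartition A) : (Σ j, A j) ≃ ι :=
  Equiv.ofBijective _ hA.bijective

/-- The identification of the disjoint union of the phase space indices of the parts with those
of all modes. -/
def IsPartition.phaseEquiv (hA : IsPartition A) : (Σ j, A j ⊕ A j) ≃ ι ⊕ ι :=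
  (Equiv.sigmaSumDistrib _ _).trans (hA.equiv.sumCongr hA.equiv)

theorem IsPartition.phaseEquiv_mk (hA : IsPartition A) (j : κ) :
    (fun a => hA.phaseEquiv ⟨j, a⟩) = blockIncl (A j) := by
  ext (a | a) <;> rfl

theorem isPartition_compl [Fintype ι] [DecidableEq ι] (B : Finset ι) :
    IsPartition ![B, Bᶜ] where
  disjoint := by
    simpa [Pairwise, Fin.forall_fin_two] using ⟨disjoint_compl_right, disjoint_compl_left⟩
  cover m := by simpa [Fin.exists_fin_two] using em (m ∈ B)

end Partition

section ProductVectors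

variable {ι κ : Type*} [Fintype ι] [Fintype κ] {A : κ → Finset ι}

theorem quasiMeasurePreserving_restrict (B : Finset ι) :
    Measure.QuasiMeasurePreserving (fun (x : ι → ℝ) (i : B) => x i) volume volume := by
  classical
  convert Measure.quasiMeasurePreserving_fst.comp
    (volume_preserving_piEquivPiSubtypeProd (fun _ : ι => ℝ) (· ∈ B)).quasiMeasurePreserving <;> rfl

theorem prod_restrict_ae_eq {f g : ∀ j, (A j → ℝ) → ℂ} (h : ∀ j, f j =ᵐ[volume] g j) :
    (fun x : ι → ℝ => ∏ j, f j fun i => x i) =ᵐ[volume] fun x => ∏ j, g j fun i => x i := by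
  have hall : ∀ᵐ x : ι → ℝ, ∀ j, f j (fun i => x i) = g j fun i => x i :=
    ae_all_iff.2 fun j => (quasiMeasurePreserving_restrict (A j)).ae (h j)
  exact hall.mono fun x hx => Finset.prod_congr rfl fun j _ => hx j

theorem weylPhase_eq_prod (hA : IsPartition A) (ξ : ι ⊕ ι → ℝ) (x : ι → ℝ) :
    weylPhase ξ x = ∏ j, weylPhase (ξ ∘ blockIncl (A j)) fun i : A j => x i := by
  simp only [weylPhase, dotProduct]
  rw [sum_eq_sum_blocks hA.equiv, sum_eq_sum_blocks hA.equiv, Finset.sum_div,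
    ← Finset.sum_sub_distrib, Complex.ofReal_sum, Finset.mul_sum, Complex.exp_sum]
  rfl

theorem chirpPhase_blockMatrix [DecidableEq κ] (hA : IsPartition A)
    (C : ∀ j, Matrix (A j) (A j) ℝ) (x : ι → ℝ) :
    chirpPhase (blockMatrix hA.equiv C) x = ∏ j, chirpPhase (C j) fun i => x i := by
  have hform : x ⬝ᵥ blockMatrix hA.equiv C *ᵥ x =
      ∑ j, (fun i : A j => x i) ⬝ᵥ C j *ᵥ fun i => x i := by
    rw [dotProduct, sum_eq_sum_blocks hA.equiv]
    exact Finset.sum_congr rfl fun j _ =>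
      congrArg ((fun i : A j => x i) ⬝ᵥ ·) (blockMatrix_mulVec hA.equiv C x j)
  simp only [chirpPhase]
  rw [hform, Finset.sum_div, Complex.ofReal_sum, Finset.mul_sum, Complex.exp_sum]

namespace IsProductVector

variable {f : ∀ j, Modes (A j)} {F : Modes ι}

theorem ext {G : Modes ι} (hF : IsProductVector A f F) (hG : IsProductVector A f G) : F = G :=
  Lp.ext (hF.trans hG.symm)

theorem smul (h : IsProductVector A f F) (c : κ → ℂ) :
    IsProductVector A (fun j => c j • f j) ((∏ j, c j) • F) := by
  refine (Lp.coeFn_smul _ _).trans (.trans ?_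
    (prod_restrict_ae_eq fun j => Lp.coeFn_smul (c j) (f j)).symm)
  filter_upwards [h] with x hx
  simp only [Pi.smul_apply, smul_eq_mul, hx, Finset.prod_mul_distrib]

theorem map_weyl (h : IsProductVector A f F) (hA : IsPartition A) (ξ : ι ⊕ ι → ℝ) :
    IsProductVector A (fun j => weyl (ξ ∘ blockIncl (A j)) (f j)) (weyl ξ F) := by
  refine (coeFn_weyl ξ h).trans (.trans (.of_forall fun x => ?_)
    (prod_restrict_ae_eq fun j => coeFn_weyl _ .rfl).symm)
  beta_reduce
  rw [weylPhase_eq_prod hA, ← Finset.prod_mul_distrib]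
  rfl

theorem map_chirp [DecidableEq κ] (h : IsProductVector A f F) (hA : IsPartition A)
    (C : ∀ j, Matrix (A j) (A j) ℝ) :
    IsProductVector A (fun j => chirp (C j) (f j)) (chirp (blockMatrix hA.equiv C) F) := by
  refine (coeFn_chirp _ h).trans (.trans (.of_forall fun x => ?_)
    (prod_restrict_ae_eq fun j => coeFn_chirp _ .rfl).symm)
  beta_reduce
  rw [chirpPhase_blockMatrix, ← Finset.prod_mul_distrib]

theorem map_dilation [DecidableEq ι] [DecidableEq κ] (h : IsProductVector A f F)
    (hA : IsPartition A) {B : ∀ j, Matrix (A j) (A j) ℝ} (hB : ∀ j, (B j).det ≠ 0) :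
    IsProductVector A (fun j => dilation (B j) (hB j) (f j))
      (dilation (blockMatrix hA.equiv B) (det_blockMatrix_ne_zero hA.equiv hB) F) := by
  refine (coeFn_dilation _ h).trans (.trans (.of_forall fun x => ?_)
    (prod_restrict_ae_eq fun j => coeFn_dilation (hB j) .rfl).symm)
  have hsqrt : √|(blockMatrix hA.equiv B).det| = ∏ j, √|(B j).det| := by
    rw [det_blockMatrix, Finset.abs_prod, Real.sqrt_prod _ fun _ _ => abs_nonneg _]
  beta_reduce
  rw [hsqrt, Complex.ofReal_prod, ← Finset.prod_mul_distrib]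
  exact Finset.prod_congr rfl fun j _ =>
    congrArg (fun y => _ * f j y) (blockMatrix_mulVec hA.equiv B x j)

end IsProductVector

theorem exists_isProductVector_ne_zero (hA : IsPartition A) :
    ∃ f F, IsProductVector A f F ∧ F ≠ 0 := by
  have hfin {α : Type _} [Fintype α] : volume (Set.Icc (0 : α → ℝ) 1) ≠ ⊤ :=
    isCompact_Icc.measure_ne_top
  refine ⟨fun j => indicatorConstLp 2 measurableSet_Icc hfin 1,
    indicatorConstLp 2 measurableSet_Icc hfin 1, ?_, ?_⟩
  · refine indicatorConstLp_coeFn.trans (.trans (.of_forall fun x => ?_)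
      (prod_restrict_ae_eq fun j => indicatorConstLp_coeFn).symm)
    have hmem : x ∈ Set.Icc (0 : ι → ℝ) 1 ↔ ∀ j, (fun i : A j => x i) ∈ Set.Icc 0 1 := by
      simp only [Set.mem_Icc, Pi.le_def, ← hA.equiv.forall_congr_right, Sigma.forall,
        forall_and]
      rfl
    classical
    simp only [Set.indicator_apply, hmem, Finset.prod_ite_zero, Finset.prod_const_one,
      Finset.mem_univ, true_implies]
  · rw [← norm_ne_zero_iff, norm_indicatorConstLp two_ne_zero ENNReal.ofNat_ne_top]
    simp [Measure.real, Real.volume_Icc_pi]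

theorem eq_zero_of_inner_weyl_eq_zero {φ ψ : Modes ι} (hψ : ψ ≠ 0)
    (h : ∀ ξ, inner ℂ φ (weyl ξ ψ) = 0) : φ = 0 := by
  have hmoyal := lintegral_enorm_sq_inner_weyl φ ψ
  have hpos : 0 < (2 * Real.pi) ^ Fintype.card ι := by positivity
  simpa [h, hψ, hpos.not_ge] using hmoyal

theorem dense_span_productVectors (hA : IsPartition A) :
    Dense (Submodule.span ℂ {F : Modes ι | ∃ f, IsProductVector A f F} : Set (Modes ι)) := by
  obtain ⟨f, F, hF, hF0⟩ := exists_isProductVector_ne_zero hA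
  rw [Submodule.dense_iff_topologicalClosure_eq_top, Submodule.topologicalClosure_eq_top_iff,
    Submodule.eq_bot_iff]
  exact fun H hH => eq_zero_of_inner_weyl_eq_zero hF0 fun ξ =>
    (Submodule.mem_orthogonal' _ _).1 hH _ (Submodule.subset_span ⟨_, hF.map_weyl hA ξ⟩)

end ProductVectors

section LocalUnitaries

variable {ι κ : Type*} [Fintype ι] [Fintype κ] {A : κ → Finset ι}

theorem intertwinesWeyl_of_local [DecidableEq κ] (hA : IsPartition A)
    {U : Modes ι ≃ₗᵢ[ℂ] Modes ι} {V : ∀ j, Modes (A j) ≃ₗᵢ[ℂ] Modes (A j)}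
    (hUV : ∀ (f : ∀ j, Modes (A j)) (F : Modes ι),
      IsProductVector A f F → IsProductVector A (fun j => V j (f j)) (U F))
    {L : ∀ j, Matrix (A j ⊕ A j) (A j ⊕ A j) ℝ} (hV : ∀ j, IntertwinesWeyl (V j) (L j)) :
    IntertwinesWeyl U (blockMatrix hA.phaseEquiv L) := by
  choose e he using hV
  let d : ι ⊕ ι → ℝ := Sigma.uncurry e ∘ hA.phaseEquiv.symm
  have hd (j : κ) (a : A j ⊕ A j) : d (hA.phaseEquiv ⟨j, a⟩) = e j a :=
    congrArg (Sigma.uncurry e) (hA.phaseEquiv.symm_apply_apply ⟨j, a⟩)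
  refine ⟨d, fun ζ G => ?_⟩
  have hphase : Complex.exp (Complex.I * ((d ⬝ᵥ ζ : ℝ) : ℂ)) =
      ∏ j, Complex.exp (Complex.I * ((e j ⬝ᵥ ζ ∘ blockIncl (A j) : ℝ) : ℂ)) := by
    rw [dotProduct, sum_eq_sum_blocks hA.phaseEquiv, Complex.ofReal_sum, Finset.mul_sum,
      Complex.exp_sum]
    simp only [hd, ← hA.phaseEquiv_mk]
    rfl
  let T₁ : Modes ι →L[ℂ] Modes ι :=
    (U : Modes ι →L[ℂ] Modes ι).comp (weylEquiv (blockMatrix hA.phaseEquiv L *ᵥ ζ) : _ →L[ℂ] _)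
  let T₂ : Modes ι →L[ℂ] Modes ι :=
    Complex.exp (Complex.I * ((d ⬝ᵥ ζ : ℝ) : ℂ)) •
      (weylEquiv ζ : Modes ι →L[ℂ] Modes ι).comp (U : Modes ι →L[ℂ] Modes ι)
  suffices T₁ = T₂ from DFunLike.congr_fun this G
  refine ContinuousLinearMap.ext_on (dense_span_productVectors hA) ?_
  rintro F ⟨f, hF⟩
  change U (weyl _ F) = Complex.exp (Complex.I * ((d ⬝ᵥ ζ : ℝ) : ℂ)) • weyl ζ (U F)
  rw [hphase]
  refine IsProductVector.ext ?_ (((hUV f F hF).map_weyl hA ζ).smul _)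
  convert hUV _ _ (hF.map_weyl hA (blockMatrix hA.phaseEquiv L *ᵥ ζ)) using 2 with j
  rw [← he]
  congr 2
  rw [← hA.phaseEquiv_mk]
  exact (blockMatrix_mulVec hA.phaseEquiv L ζ j).symm

/-- The local version of `(chirp (-C)).trans (dilation B)`: chirps and dilations of the parts are
the chirp and the dilation with the block diagonal matrices. -/
def localChirpDilation [DecidableEq ι] [DecidableEq κ] (hA : IsPartition A)
    (B C : ∀ j, Matrix (A j) (A j) ℝ) (hB : ∀ j, (B j).det ≠ 0) : Modes ι ≃ₗᵢ[ℂ] Modes ι :=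
  (chirp (blockMatrix hA.equiv fun j => -C j)).trans
    (dilation (blockMatrix hA.equiv B) (det_blockMatrix_ne_zero hA.equiv hB))

theorem IsProductVector.map_localChirpDilation [DecidableEq ι] [DecidableEq κ]
    (hA : IsPartition A) (B C : ∀ j, Matrix (A j) (A j) ℝ) (hB : ∀ j, (B j).det ≠ 0)
    {f : ∀ j, Modes (A j)} {F : Modes ι} (h : IsProductVector A f F) :
    IsProductVector A (fun j => (chirp (-C j)).trans (dilation (B j) (hB j)) (f j))
      (localChirpDilation hA B C hB F) :=
  (h.map_chirp hA fun j => -C j).map_dilation hA hB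

theorem IsLocalGaussianUnitary.trans [DecidableEq ι] {U U' : Modes ι ≃ₗᵢ[ℂ] Modes ι}
    (hU : IsLocalGaussianUnitary A U) (hU' : IsLocalGaussianUnitary A U') :
    IsLocalGaussianUnitary A (U.trans U') := by
  obtain ⟨V, hV, hUV⟩ := hU
  obtain ⟨V', hV', hUV'⟩ := hU'
  exact ⟨fun j => (V j).trans (V' j), fun j => (hV j).trans (hV' j),
    fun f F hF => hUV' _ _ (hUV f F hF)⟩

theorem isLocalGaussianUnitary_weylEquiv [DecidableEq ι] (hA : IsPartition A) (ξ : ι ⊕ ι → ℝ) :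
    IsLocalGaussianUnitary A (weylEquiv ξ) :=
  ⟨fun j => weylEquiv (ξ ∘ blockIncl (A j)), fun _ => isGaussianUnitary_weylEquiv _,
    fun _ _ hF => hF.map_weyl hA ξ⟩

theorem isLocalGaussianUnitary_localChirpDilation [DecidableEq ι] [DecidableEq κ]
    (hA : IsPartition A) {B C : ∀ j, Matrix (A j) (A j) ℝ} (hB : ∀ j, (B j).det ≠ 0)
    (hC : ∀ j, (C j)ᵀ = C j) : IsLocalGaussianUnitary A (localChirpDilation hA B C hB) :=
  ⟨fun j => (chirp (-C j)).trans (dilation (B j) (hB j)),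
    fun j => isGaussianUnitary_chirp_trans_dilation (hB j) (hC j),
    fun _ _ hF => hF.map_localChirpDilation hA B C hB⟩

theorem HasGaussianChar.isLeast_localEnergies [DecidableEq ι]
    {φ : Modes ι} {d : ι ⊕ ι → ℝ} {M : Matrix (ι ⊕ ι) (ι ⊕ ι) ℝ} (h : HasGaussianChar φ d M)
    (hA : IsPartition A) :
    IsLeast (localEnergies A φ)
      (∑ j, (symplecticEigenvalues (M.submatrix (blockIncl (A j)) (blockIncl (A j)))).sum / 2) := by
  classical
  have hM (j : κ) := posDef_block h.isPureCovariance.posDef (A j)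
  have htrace (L : ∀ j, Matrix (A j ⊕ A j) (A j ⊕ A j) ℝ) :
      ((blockMatrix hA.phaseEquiv L)ᵀ * M * blockMatrix hA.phaseEquiv L).trace =
        ∑ j, ((L j)ᵀ * M.submatrix (blockIncl (A j)) (blockIncl (A j)) * L j).trace := by
    simp only [trace_eq_sum_trace_blocks hA.phaseEquiv, blockMatrix_congr_submatrix,
      ← hA.phaseEquiv_mk]
  constructor
  · choose B C hB hC hBC using fun j => exists_trace_lowerSymplectic_congr (hM j)
    obtain ⟨d', h'⟩ := h.map (intertwinesWeyl_of_local hA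
      (fun f F => IsProductVector.map_localChirpDilation hA B C hB)
      fun j => intertwinesWeyl_chirp_trans_dilation (hB j) (hC j))
    refine ⟨(localChirpDilation hA B C hB).trans (weylEquiv (J ι ℝ *ᵥ d')),
      (isLocalGaussianUnitary_localChirpDilation hA hB hC).trans
        (isLocalGaussianUnitary_weylEquiv hA _), h'.center.finiteEnergy, ?_⟩
    rw [LinearIsometryEquiv.trans_apply, h'.energy_center, htrace, Finset.sum_div]
    exact Finset.sum_congr rfl fun j _ => by rw [hBC]; ring
  · rintro _ ⟨U, ⟨V, hV, hUV⟩, -, rfl⟩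
    choose L hL hVL using fun j => (hV j).exists_intertwinesWeyl
    obtain ⟨d', h'⟩ := h.map (intertwinesWeyl_of_local hA hUV hVL)
    refine le_trans ?_ h'.trace_le_energy
    rw [htrace, Finset.sum_div]
    refine Finset.sum_le_sum fun j _ => ?_
    linarith [two_mul_sum_symplecticEigenvalues_le_trace_congr (hL j) (hM j)]

end LocalUnitaries

section Gap

variable {ι κ : Type*} [Fintype ι] [DecidableEq ι] [Fintype κ] {A : κ → Finset ι}
  {φ : Modes ι} {d : ι ⊕ ι → ℝ} {M : Matrix (ι ⊕ ι) (ι ⊕ ι) ℝ}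

theorem sum_symplecticEigenvalues_sub_one (hM : M.PosDef) :
    ((symplecticEigenvalues M).map fun ν => ν - 1).sum =
      (symplecticEigenvalues M).sum - Fintype.card ι := by
  rw [Multiset.sum_map_sub, Multiset.map_id', Multiset.map_const', Multiset.sum_replicate,
    card_symplecticEigenvalues hM, nsmul_one]

theorem HasGaussianChar.ergotropicGap_eq (h : HasGaussianChar φ d M) (hA : IsPartition A) :
    ergotropicGap A φ = (1 / 2) * ∑ j, ((symplecticEigenvalues
      (M.submatrix (blockIncl (A j)) (blockIncl (A j)))).map fun ν => ν - 1).sum := by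
  have hcard : (Fintype.card ι : ℝ) = ∑ j, (Fintype.card (A j) : ℝ) := by
    rw [← Fintype.card_congr hA.equiv, Fintype.card_sigma, Nat.cast_sum]
  have hM := h.isPureCovariance
  simp only [sum_symplecticEigenvalues_sub_one (posDef_block hM.posDef _)]
  rw [ergotropicGap, globalErgotropy, localErgotropy, h.isLeast_globalEnergies.csInf_eq,
    (h.isLeast_localEnergies hA).csInf_eq, hM.sum_symplecticEigenvalues, hcard,
    Finset.sum_sub_distrib, ← Finset.sum_div]
  ring

theorem HasGaussianChar.ergotropicGap_compl_eq (h : HasGaussianChar φ d M) (B : Finset ι) :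
    ergotropicGap ![B, Bᶜ] φ = ((symplecticEigenvalues
      (M.submatrix (blockIncl B) (blockIncl B))).map fun ν => ν - 1).sum := by
  have hhalf {x y : ℝ} (hyx : y = x) : 1 / 2 * (x + y) = x := by rw [hyx]; ring
  rw [h.ergotropicGap_eq (isPartition_compl B), Fin.sum_univ_two]
  exact hhalf (h.isPureCovariance.sum_sub_one_compl B)

end Gap

end ErgotropicGap

end

theorem lemma2_general {ι κ : Type*} [Fintype ι] [DecidableEq ι] [Fintype κ]
    (ψ : ErgotropicGap.Modes ι) (hψ : ErgotropicGap.IsPureGaussian ψ) (A : κ → Finset ι)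
    (hdisj : Pairwise fun i j => Disjoint (A i) (A j))
    (hcover : ∀ m, ∃ j, m ∈ A j) :
    ErgotropicGap.FiniteEnergy ψ ∧
    IsLeast (ErgotropicGap.globalEnergies ψ) (sInf (ErgotropicGap.globalEnergies ψ)) ∧
    IsLeast (ErgotropicGap.localEnergies A ψ) (sInf (ErgotropicGap.localEnergies A ψ)) ∧
    (∀ j, IsLeast (ErgotropicGap.localEnergies ![A j, (A j)ᶜ] ψ)
      (sInf (ErgotropicGap.localEnergies ![A j, (A j)ᶜ] ψ))) ∧
    (∀ j, (ErgotropicGap.symplecticEigenvalues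
      (ErgotropicGap.reducedCov (A j) ψ)).card = (A j).card) ∧
    ErgotropicGap.ergotropicGap A ψ =
      (1 / 2) * ∑ j, ((ErgotropicGap.symplecticEigenvalues
        (ErgotropicGap.reducedCov (A j) ψ)).map fun ν => ν - 1).sum ∧
    ErgotropicGap.ergotropicGap A ψ =
      (1 / 2) * ∑ j, ErgotropicGap.ergotropicGap ![A j, (A j)ᶜ] ψ ∧
    (∀ j, ErgotropicGap.ergotropicGap ![A j, (A j)ᶜ] ψ =
      ((ErgotropicGap.symplecticEigenvalues
        (ErgotropicGap.reducedCov (A j) ψ)).map fun ν => ν - 1).sum) := by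
  obtain ⟨-, d, M, hsymm, hchar⟩ := hψ
  have h : ErgotropicGap.HasGaussianChar ψ d M := ⟨hsymm, hchar⟩
  have hA : ErgotropicGap.IsPartition A := ⟨hdisj, hcover⟩
  have hleast : ∀ {s : Set ℝ} {a : ℝ}, IsLeast s a → IsLeast s (sInf s) := fun hs =>
    hs.csInf_eq ▸ hs
  simp only [h.symplecticEigenvalues_reducedCov, h.ergotropicGap_compl_eq]
  refine ⟨h.finiteEnergy, hleast h.isLeast_globalEnergies, hleast (h.isLeast_localEnergies hA),
    fun j => hleast (h.isLeast_localEnergies (ErgotropicGap.isPartition_compl (A j))),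
    fun j => ?_, h.ergotropicGap_eq hA, h.ergotropicGap_eq hA, fun _ => trivial⟩
  rw [ErgotropicGap.card_symplecticEigenvalues
    (ErgotropicGap.posDef_block h.isPureCovariance.posDef (A j)), Fintype.card_coe]

theorem lemma2 (N k : ℕ) (ψ : ErgotropicGap.Modes (Fin N))
    (hψ : ErgotropicGap.IsPureGaussian ψ)
    (A : Fin k → Finset (Fin N)) (hne : ∀ j, (A j).Nonempty)
    (hdisj : Pairwise fun i j => Disjoint (A i) (A j))
    (hcover : ∀ m, ∃ j, m ∈ A j) :
    -- the energy of the state is finite and all the minima that enter the gaps are attained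
    ErgotropicGap.FiniteEnergy ψ ∧
    IsLeast (ErgotropicGap.globalEnergies ψ) (sInf (ErgotropicGap.globalEnergies ψ)) ∧
    IsLeast (ErgotropicGap.localEnergies A ψ) (sInf (ErgotropicGap.localEnergies A ψ)) ∧
    (∀ j, IsLeast (ErgotropicGap.localEnergies ![A j, (A j)ᶜ] ψ)
      (sInf (ErgotropicGap.localEnergies ![A j, (A j)ᶜ] ψ))) ∧
    -- there are `m_j = |A_j|` symplectic eigenvalues in each part
    (∀ j, (ErgotropicGap.symplecticEigenvalues
      (ErgotropicGap.reducedCov (A j) ψ)).card = (A j).card) ∧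
    -- the gap in terms of the symplectic eigenvalues
    ErgotropicGap.ergotropicGap A ψ =
      (1 / 2) * ∑ j, ((ErgotropicGap.symplecticEigenvalues
        (ErgotropicGap.reducedCov (A j) ψ)).map fun ν => ν - 1).sum ∧
    -- the gap in terms of the gaps of the bipartitions
    ErgotropicGap.ergotropicGap A ψ =
      (1 / 2) * ∑ j, ErgotropicGap.ergotropicGap ![A j, (A j)ᶜ] ψ ∧
    (∀ j, ErgotropicGap.ergotropicGap ![A j, (A j)ᶜ] ψ =
      ((ErgotropicGap.symplecticEigenvalues
        (ErgotropicGap.reducedCov (A j) ψ)).map fun ν => ν - 1).sum) :=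
  lemma2_general ψ hψ A hdisj hcover
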